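/- **Setting.** Let $n,m\ge 1$ be integers, let $\mathbf D,A$ be real $n\times n$ matrices and $B$ a real $n\times m$ matrix. Let $a:[0,1]\to\mathbb R$ satisfy one of the following two conditions. * (WD) $a\in C([0,1])\cap C^1((0,1])$, $a>0$ on $(0,1]$, $a(0)=0$, and there is $K\in[0,1)$ with $xa'(x)\le Ka(x)$ for all $x\in(0,1]$. * (SD) $a\in C^1([0,1])$, $a>0$ on $(0,1]$, $a(0)=0$, and there is $K\in[1,2)$ with $xa'(x)\le Ka(x)$ for all $x\in[0,1]$ such that $x\mapsto a(x)/x^\theta$ is nondecreasing near $0$ for some $\theta\in(1,K]$ if $K>1$, and for some $\theta\in(0,1)$ if $K=1$. Let $H^1_a$ be the set of $u\in L^2(0,1)$ (real-valued) with $\sqrt a\,u_x\in L^2(0,1)$ such that, in case (WD), $u$ is absolutely continuous on $[0,1]$ and $u(0)=u(1)=0$, and, in case (SD), $u$ is locally absolutely continuous on $(0,1]$ and $u(1)=0$. Let $\mathcal M u=(au_x)_x$ with domain $D(\mathcal M)=H^2_a=\{u\in H^1_a: au_x\in H^1(0,1)\}\subset L^2(0,1)$; $\mathcal M^k$ acts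 componentwise on $D(\mathcal M^k)^j$. Put $\mathbb D=\bigcap_{p\ge0}D(\mathcal M^p)$, $L=\mathbf D\mathcal M+A$ and $L^*=\mathbf D^{*}\mathcal M+A^{*}$ on $D(\mathcal M)^n$. The Kalman operator is $\mathcal K=[L^{n-1}B\,|\,L^{n-2}B\,|\cdots|\,LB\,|\,B]$ from $L^2(0,1)^{nm}$ to $L^2(0,1)^n$ with its maximal domain $D(\mathcal K)=\{u\in L^2(0,1)^{nm}:\mathcal Ku\in L^2(0,1)^n\}$; here, writing $u=(u_0,\dots,u_{n-1})$ with $u_j\in L^2(0,1)^m$, the equality $\mathcal Ku=f\in L^2(0,1)^n$ means $\langle f,\varphi\rangle=\sum_{j=0}^{n-1}\langle Bu_j,(L^*)^{n-1-j}\varphi\rangle$ for all $\varphi\in\mathbb D^n$. Let $\mathcal K^*$ be the Hilbert space adjoint of $\mathcal K$. **Theorem.** 1. There is a constant $C>0$ such that every $u\in D(\mathcal M^{n-1})^{nm}$ belongs to $D(\mathcal K)$ and satisfies $$\|\mathcal Ku\|^2_{L^2(0,1)^n}\le C\,\|\mathcal M^{n-1}u\|^2_{L^2(0,1)^{nm}}.$$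 2. There is a constant $C>0$ such that every $u\in D(\mathcal M^{n-1})^{n}$ belongs to $D(\mathcal K^*)$ and satisfies $$\|\mathcal K^*u\|^2_{L^2(0,1)^{nm}}\le C\,\|\mathcal M^{n-1}u\|^2_{L^2(0,1)^{n}}.$$ 3. If $\operatorname{Ker}\mathcal K^*=\{0\}$, there is a constant $C>0$ such that for every integer $k\ge(2n-1)(n-1)$ and every $\varphi\in D(\mathcal K^*)$ with $\mathcal K^*\varphi\in D(\mathcal M^k)^{nm}$ one has $\varphi\in D(\mathcal M^{k-(2n-1)(n-1)})^n$ and $$\|\mathcal M^{k-(2n-1)(n-1)}\varphi\|^2_{L^2(0,1)^n}\le C\,\|\mathcal M^k\mathcal K^*\varphi\|^2_{L^2(0,1)^{nm}}.$$ -/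

import Mathlib

open MeasureTheory Set
open scoped ContDiff Matrix

noncomputable section

namespace DegenerateKalman

/-- The two ways in which the diffusion coefficient may degenerate at `0`. -/
inductive Degeneracy
  | weak
  | strong

/-- Weak degeneracy: `a ∈ C([0,1]) ∩ C¹((0,1])`, `a > 0` on `(0,1]`, `a(0) = 0`, and
`x a'(x) ≤ K a(x)` for some `K ∈ [0,1)`. (At `x = 0` the last inequality reads `0 ≤ 0`.) -/
structure WeaklyDegenerate (a : ℝ → ℝ) : Prop where
  continuousOn : ContinuousOn a (Icc 0 1)
  contDiffOn : ContDiffOn ℝ 1 a (Ioc 0 1)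
  pos : ∀ x ∈ Ioc (0 : ℝ) 1, 0 < a x
  zero : a 0 = 0
  growth : ∃ K ∈ Ico (0 : ℝ) 1, ∀ x ∈ Ioc (0 : ℝ) 1,
    x * derivWithin a (Ioc 0 1) x ≤ K * a x

/-- Strong degeneracy: `a ∈ C¹([0,1])`, `a > 0` on `(0,1]`, `a(0) = 0`, `x a'(x) ≤ K a(x)` for
some `K ∈ [1,2)`, and `a(x) / x ^ θ` is nondecreasing near `0` for some `θ ∈ (1,K]` if `K > 1`,
for some `θ ∈ (0,1)` if `K = 1`. -/
structure StronglyDegenerate (a : ℝ → ℝ) : Prop where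
  contDiffOn : ContDiffOn ℝ 1 a (Icc 0 1)
  pos : ∀ x ∈ Ioc (0 : ℝ) 1, 0 < a x
  zero : a 0 = 0
  growth : ∃ K ∈ Ico (1 : ℝ) 2,
    (∀ x ∈ Icc (0 : ℝ) 1, x * derivWithin a (Icc 0 1) x ≤ K * a x) ∧
    (1 < K → ∃ θ ∈ Ioc 1 K, ∃ δ > 0, MonotoneOn (fun x => a x / x ^ θ) (Ioc 0 δ)) ∧
    (K = 1 → ∃ θ ∈ Ioo (0 : ℝ) 1, ∃ δ > 0, MonotoneOn (fun x => a x / x ^ θ) (Ioc 0 δ))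

/-- `a` is a diffusion coefficient of the given type of degeneracy. -/
def IsDiffusion : Degeneracy → (ℝ → ℝ) → Prop
  | .weak, a => WeaklyDegenerate a
  | .strong, a => StronglyDegenerate a

/-- Lebesgue measure on `(0,1)`. -/
abbrev unitMeasure : Measure ℝ := volume.restrict (Ioo 0 1)

/-- The real Hilbert space `L²(0,1)`. -/
abbrev L2 : Type := Lp ℝ 2 unitMeasure

/-- The Hilbert space `L²(0,1)^ι`, with norm `‖u‖² = ∑ i, ‖u i‖²`. -/
abbrev L2Vec (ι : Type) [Fintype ι] : Type := PiLp 2 (fun _ : ι => L2)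

/-- The function `v` belongs to `H¹ₐ(0,1)` (as the representative that is absolutely continuous).
* weak case: `v` is absolutely continuous on `[0,1]`, `√a v' ∈ L²(0,1)`, `v(0) = v(1) = 0`;
* strong case: `v` is (locally) absolutely continuous on `(0,1]`, `√a v' ∈ L²(0,1)`, `v(1) = 0`. -/
def MemH1a : Degeneracy → (ℝ → ℝ) → (ℝ → ℝ) → Prop
  | .weak, a, v =>
      MemLp v 2 unitMeasure ∧ AbsolutelyContinuousOnInterval v 0 1 ∧
      MemLp (fun x => √(a x) * deriv v x) 2 unitMeasure ∧ v 0 = 0 ∧ v 1 = 0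
  | .strong, a, v =>
      MemLp v 2 unitMeasure ∧ (∀ ε ∈ Ioo (0 : ℝ) 1, AbsolutelyContinuousOnInterval v ε 1) ∧
      MemLp (fun x => √(a x) * deriv v x) 2 unitMeasure ∧ v 1 = 0

/-- `g ∈ H¹(0,1)` with weak derivative `f`: both lie in `L²(0,1)`, and `∫ g φ' = - ∫ f φ` for all
`φ ∈ C_c^∞(0,1)`. -/
def HasH1Deriv (g f : ℝ → ℝ) : Prop :=
  MemLp g 2 unitMeasure ∧ MemLp f 2 unitMeasure ∧
  ∀ φ : ℝ → ℝ, ContDiff ℝ ∞ φ → HasCompactSupport φ → tsupport φ ⊆ Ioo 0 1 →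
    ∫ x in Ioo (0 : ℝ) 1, g x * deriv φ x = - ∫ x in Ioo (0 : ℝ) 1, f x * φ x

section Operators

variable (d : Degeneracy) (a : ℝ → ℝ)

/-- Graph of the degenerate operator `M u = (a uₓ)ₓ`: `IsM d a u f` says that
`u ∈ D(M) = H²ₐ(0,1) = {u ∈ H¹ₐ(0,1) : a uₓ ∈ H¹(0,1)}` and `M u = f`. -/
def IsM (u f : L2) : Prop :=
  ∃ v : ℝ → ℝ, u =ᵐ[unitMeasure] v ∧ MemH1a d a v ∧ HasH1Deriv (fun x => a x * deriv v x) f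

/-- Graph of `M ^ k`: `u ∈ D(M ^ k)` and `M ^ k u = f`. -/
def IsMPow : ℕ → L2 → L2 → Prop
  | 0, u, f => f = u
  | k + 1, u, f => ∃ g, IsMPow k u g ∧ IsM d a g f

/-- Graph of `M ^ k` acting componentwise: `u ∈ D(M ^ k) ^ ι` and `M ^ k u = w`. -/
def IsMPowVec {ι : Type} [Fintype ι] (k : ℕ) (u w : L2Vec ι) : Prop :=
  ∀ i, IsMPow d a k (u i) (w i)

/-- The space `𝔻 = ⋂ p, D(M ^ p)`. -/
def smoothDomain : Set L2 := {u | ∀ p, ∃ f, IsMPow d a p u f}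

/-- A constant matrix acting on a vector of functions. -/
def matAct {ι κ : Type} [Fintype ι] [Fintype κ] (X : Matrix κ ι ℝ) (u : L2Vec ι) : L2Vec κ :=
  WithLp.toLp 2 (fun i => ∑ j, X i j • u j)

variable {n m : ℕ}

/-- Graph of the operator `X M + Y` with domain `D(M) ^ n`. With `X = D`, `Y = A` it is
`L = D M + A`; with `X = Dᵀ`, `Y = Aᵀ` it is the formal adjoint `L* = D* M + A*`. -/
def IsL (X Y : Matrix (Fin n) (Fin n) ℝ) (φ ψ : L2Vec (Fin n)) : Prop :=
  ∃ η, IsMPowVec d a 1 φ η ∧ ψ = matAct X η + matAct Y φ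

/-- Graph of the power `(X M + Y) ^ q`. -/
def IsLPow (X Y : Matrix (Fin n) (Fin n) ℝ) : ℕ → L2Vec (Fin n) → L2Vec (Fin n) → Prop
  | 0, φ, ψ => ψ = φ
  | q + 1, φ, ψ => ∃ η, IsLPow X Y q φ η ∧ IsL d a X Y η ψ

/-- The `j`-th block (with `m` components) of `u ∈ L²(0,1)^{nm}`. -/
def block (u : L2Vec (Fin n × Fin m)) (j : Fin n) : L2Vec (Fin m) :=
  WithLp.toLp 2 (fun i => u (j, i))

/-- Graph of the Kalman operator `𝒦 = [L ^ (n-1) B | ⋯ | L B | B]`, with its maximal domain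
`D(𝒦) = {u ∈ L²(0,1)^{nm} : 𝒦 u ∈ L²(0,1)^n}`. For a general `u` the expression
`𝒦 u = ∑ j, L ^ (n-1-j) B u_j` (blocks `u_j`, `j = 0, …, n-1`) is a linear functional on the test
space `𝔻 ^ n`, where `L ^ q g` is the functional `φ ↦ ⟪g, (L*) ^ q φ⟫`; that `𝒦 u = f ∈ L²(0,1)^n`
means that this functional is `φ ↦ ⟪f, φ⟫`. -/
def IsKalman (D A : Matrix (Fin n) (Fin n) ℝ) (B : Matrix (Fin n) (Fin m) ℝ)
    (u : L2Vec (Fin n × Fin m)) (f : L2Vec (Fin n)) : Prop :=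
  ∀ φ : L2Vec (Fin n), (∀ i, φ i ∈ smoothDomain d a) →
    ∀ ψ : Fin n → L2Vec (Fin n), (∀ j : Fin n, IsLPow d a Dᵀ Aᵀ (n - 1 - (j : ℕ)) φ (ψ j)) →
      inner ℝ f φ = ∑ j, inner ℝ (matAct B (block u j)) (ψ j)

/-- Graph of the Hilbert space adjoint `𝒦*` of the Kalman operator: `φ ∈ D(𝒦*)` and `𝒦* φ = w`
iff `⟪𝒦 u, φ⟫ = ⟪u, w⟫` for all `u ∈ D(𝒦)`. -/
def IsKalmanAdjoint (D A : Matrix (Fin n) (Fin n) ℝ) (B : Matrix (Fin n) (Fin m) ℝ)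
    (φ : L2Vec (Fin n)) (w : L2Vec (Fin n × Fin m)) : Prop :=
  ∀ u f, IsKalman d a D A B u f → inner ℝ f φ = inner ℝ u w

end Operators

end DegenerateKalman

end

open DegenerateKalman

/-! The operator `M` has a bounded inverse `G` that is injective, symmetric and compact; once this
is known, the estimates are statements about matrices of polynomials in `G`.

Integrating `a v' = ∫₀ˣ f - c` from `1` gives `G = -V* Q V` with `V f = a^{-1/2} ∫₀ˣ f`. The growth
condition gives `a(x) ≥ a(1) x^K` with `K < 2`, so `x / a` is integrable and `V` is Hilbert-Schmidt.
The constant `c` is fixed by the behaviour at `0`. In the strong case `1/a` is not integrable, which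
forces `c = 0` and `Q = 1`. In the weak case `v(0) = 0` determines `c`, and `Q` is the projection
onto the orthogonal complement of `a^{-1/2}` (`Admissible.exists_inverse_strong`,
`Admissible.exists_inverse_weak`).

Now `D(M^k)` is the range of `G^k`, and `L* G = D* + G A*` is bounded. Hence there is a polynomial
matrix `S`, the `kalmanSymbol`, such that `𝒦 u = f` means `G^{n-1} f = S(G)ᵀ u` (`isKalman_iff`) and
`𝒦* G^{n-1} w = S(G) w`. The first two estimates are the boundedness of `S(G)ᵀ` and `S(G)`.

For the third, let `q = det (Sᵀ S)`. A zero of `q` at an eigenvalue of `G` would produce a nonzero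
element of the kernel of `𝒦*`. Hence `q = X^s r` with `r(G)` invertible, by the Fredholm
alternative, and `s ≤ deg q ≤ 2n(n-1)`. Applying `adj(Sᵀ S) Sᵀ` to `S(G) φ = G^{n-1} 𝒦* φ` gives
`G^s r(G) φ = G^{n-1} W(G) 𝒦* φ` with `W = adj(Sᵀ S) Sᵀ`. The loss of powers of `M` is therefore at
most `2n(n-1) - (n-1) = (2n-1)(n-1)`. -/

namespace DegenerateKalman

open Polynomial Module.End

/-! ### Polynomial matrices in a compact symmetric operator -/

section Algebra

variable {H : Type*} [NormedAddCommGroup H] [InnerProductSpace ℝ H]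
variable {ι κ τ : Type*} [Fintype ι] [Fintype τ]

/-- A matrix of polynomials acting on vectors over `H` by evaluation at the operator `G`. -/
noncomputable def polyAct (G : H →L[ℝ] H) (P : Matrix κ ι ℝ[X]) :
    PiLp 2 (fun _ : ι => H) →L[ℝ] PiLp 2 (fun _ : κ => H) :=
  (PiLp.continuousLinearEquiv 2 ℝ (fun _ : κ => H)).symm.toContinuousLinearMap ∘L
    ContinuousLinearMap.pi
      (fun i => ∑ j, (aeval G (P i j)) ∘L (PiLp.proj 2 (fun _ : ι => H) j : _ →L[ℝ] H))

variable (G : H →L[ℝ] H)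

lemma polyAct_apply (P : Matrix κ ι ℝ[X]) (u : PiLp 2 (fun _ : ι => H)) (i : κ) :
    polyAct G P u i = ∑ j, aeval G (P i j) (u j) := by
  simp [polyAct]

lemma polyAct_mul (P : Matrix κ ι ℝ[X]) (Q : Matrix ι τ ℝ[X]) (u : PiLp 2 (fun _ : τ => H)) :
    polyAct G (P * Q) u = polyAct G P (polyAct G Q u) := by
  ext i
  simp only [polyAct_apply, Matrix.mul_apply, map_sum, map_mul, sum_apply,
    mul_apply_eq_comp]
  exact Finset.sum_comm

lemma polyAct_add (P Q : Matrix κ ι ℝ[X]) (u : PiLp 2 (fun _ : ι => H)) :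
    polyAct G (P + Q) u = polyAct G P u + polyAct G Q u := by
  ext i
  simp [polyAct_apply, Finset.sum_add_distrib]

lemma polyAct_smul_one_apply [DecidableEq ι] (p : ℝ[X]) (u : PiLp 2 (fun _ : ι => H)) (i : ι) :
    polyAct G (p • (1 : Matrix ι ι ℝ[X])) u i = aeval G p (u i) := by
  rw [polyAct_apply, Finset.sum_eq_single i]
  · simp
  · intro j _ hj
    simp [Matrix.one_apply_ne' hj]
  · simp

lemma polyAct_smul_one_mul [DecidableEq ι] (p q : ℝ[X]) (u : PiLp 2 (fun _ : ι => H)) :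
    polyAct G ((p * q) • (1 : Matrix ι ι ℝ[X])) u =
      polyAct G (p • (1 : Matrix ι ι ℝ[X])) (polyAct G (q • (1 : Matrix ι ι ℝ[X])) u) := by
  rw [← polyAct_mul, smul_mul_smul_comm, one_mul]

/-- Scalar polynomials commute with matrices of polynomials. -/
lemma polyAct_comm [DecidableEq ι] [DecidableEq κ] [Fintype κ] (p : ℝ[X]) (P : Matrix κ ι ℝ[X])
    (u : PiLp 2 (fun _ : ι => H)) :
    polyAct G P (polyAct G (p • (1 : Matrix ι ι ℝ[X])) u) =
      polyAct G (p • (1 : Matrix κ κ ℝ[X])) (polyAct G P u) := by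
  rw [← polyAct_mul, ← polyAct_mul]
  simp

variable {G}

lemma inner_aeval (hG : (G : H →ₗ[ℝ] H).IsSymmetric) (p : ℝ[X]) (x y : H) :
    inner ℝ (aeval G p x) y = inner ℝ x (aeval G p y) := by
  induction p using Polynomial.induction_on generalizing x y with
  | C c => simp [Algebra.algebraMap_eq_smul_one, inner_smul_left, inner_smul_right]
  | add p q hp hq => simp [inner_add_left, inner_add_right, hp, hq]
  | monomial k c h =>
    have e : aeval G (C c * X ^ (k + 1)) = aeval G (C c * X ^ k) * G := by
      rw [pow_succ, ← mul_assoc, map_mul, aeval_X]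
    have e' : aeval G (C c * X ^ (k + 1)) = G * aeval G (C c * X ^ k) := by
      rw [pow_succ', mul_left_comm, map_mul, aeval_X]
    calc inner ℝ (aeval G (C c * X ^ (k + 1)) x) y
        = inner ℝ (aeval G (C c * X ^ k) (G x)) y := by rw [e]; rfl
      _ = inner ℝ x (G (aeval G (C c * X ^ k) y)) := by rw [h]; exact hG x _
      _ = inner ℝ x (aeval G (C c * X ^ (k + 1)) y) := by rw [e']; rfl

lemma inner_polyAct [Fintype κ] (hG : (G : H →ₗ[ℝ] H).IsSymmetric) (P : Matrix κ ι ℝ[X])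
    (u : PiLp 2 (fun _ : ι => H)) (v : PiLp 2 (fun _ : κ => H)) :
    inner ℝ (polyAct G P u) v = inner ℝ u (polyAct G Pᵀ v) := by
  simp only [PiLp.inner_apply, polyAct_apply, sum_inner, inner_sum, Matrix.transpose_apply,
    inner_aeval hG]
  exact Finset.sum_comm

lemma aeval_X_pow_injective (hinj : Function.Injective G) (k : ℕ) :
    Function.Injective (aeval G (X ^ k : ℝ[X])) := by
  induction k with
  | zero => intro x y h; simpa using h
  | succ k ih =>
    intro x y h
    rw [pow_succ, map_mul, aeval_X] at h
    exact hinj (ih h)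

lemma polyAct_X_pow_injective [DecidableEq ι] (hinj : Function.Injective G) (k : ℕ) :
    Function.Injective (polyAct G ((X ^ k : ℝ[X]) • (1 : Matrix ι ι ℝ[X]))) := by
  intro u v h
  ext i
  have := congrArg (fun w => w i) h
  simp only [polyAct_smul_one_apply] at this
  exact aeval_X_pow_injective hinj k this

lemma aeval_of_eigen {x : H} {μ : ℝ} (hx : G x = μ • x) (p : ℝ[X]) :
    aeval G p x = p.eval μ • x := by
  induction p using Polynomial.induction_on with
  | C c => simp [Algebra.algebraMap_eq_smul_one]
  | add p q hp hq => simp [hp, hq, add_smul]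
  | monomial k c h =>
    have e : aeval G (C c * X ^ (k + 1)) = aeval G (C c * X ^ k) * G := by
      rw [pow_succ, ← mul_assoc, map_mul, aeval_X]
    calc aeval G (C c * X ^ (k + 1)) x = aeval G (C c * X ^ k) (G x) := by rw [e]; rfl
      _ = _ := by
        rw [hx, map_smul, h, smul_smul]
        congr 1
        simp
        ring

/-- On vectors whose entries are multiples of one eigenvector, operator questions reduce to linear
algebra for the real matrix `P(μ)`. -/
lemma polyAct_of_eigen {x : H} {μ : ℝ} (hx : G x = μ • x) (P : Matrix κ ι ℝ[X]) (c : ι → ℝ) :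
    polyAct G P (WithLp.toLp 2 fun i => c i • x) =
      WithLp.toLp 2 fun i => ((P.map (eval μ)).mulVec c) i • x := by
  ext i
  rw [polyAct_apply]
  simp [aeval_of_eigen hx, Matrix.mulVec, dotProduct, Finset.sum_smul, smul_smul, mul_comm]

/-- A vector orthogonal to all eigenvectors of a compact symmetric operator vanishes. -/
lemma eq_zero_of_orthogonal_eigen [CompleteSpace H] (hG : (G : H →ₗ[ℝ] H).IsSymmetric)
    (hc : IsCompactOperator G) {x : H}
    (h : ∀ (μ : ℝ) (e : H), G e = μ • e → inner ℝ x e = 0) : x = 0 := by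
  have hb := ContinuousLinearMap.orthogonalComplement_iSup_eigenspaces_eq_bot hc hG
  have : x ∈ (⨆ μ, eigenspace (G : Module.End ℝ H) μ)ᗮ := by
    rw [← Submodule.iInf_orthogonal, Submodule.mem_iInf]
    intro μ
    rw [Submodule.mem_orthogonal']
    intro e he
    exact h μ e (mem_eigenspace_iff.mp he)
  rw [hb] at this
  simpa using this

/-- If `q(0) ≠ 0` and `q` does not vanish on the eigenvalues of the compact symmetric operator
`G`, then `q(G)` is invertible. -/
lemma isUnit_aeval [CompleteSpace H] (hG : (G : H →ₗ[ℝ] H).IsSymmetric)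
    (hc : IsCompactOperator G) {q : ℝ[X]} (h0 : q.eval 0 ≠ 0)
    (hq : ∀ (μ : ℝ) (e : H), e ≠ 0 → G e = μ • e → q.eval μ ≠ 0) : IsUnit (aeval G q) := by
  -- Splitting off the constant term, `q(G) = q(0) + T` with `T` compact, so `q(G)` is invertible
  -- unless `-q(0)` is an eigenvalue of `T`.
  set T : H →L[ℝ] H := aeval G q.divX * G with hT
  have hTc : IsCompactOperator T := hc.clm_comp (aeval G q.divX)
  have hqT : aeval G q = algebraMap ℝ _ (q.eval 0) + T := by
    conv_lhs => rw [← divX_mul_X_add q]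
    rw [map_add, map_mul, aeval_X, aeval_C, coeff_zero_eq_eval_zero, add_comm]
  rcases hTc.hasEigenvalue_or_mem_resolventSet (neg_ne_zero.mpr h0) with h | h
  · exfalso
    obtain ⟨v, hv⟩ := h.exists_hasEigenvector
    have hv1 : T v = (-(q.eval 0)) • v := mem_eigenspace_iff.mp hv.1
    have hqv : aeval G q v = 0 := by
      rw [hqT]
      simp [hv1, Algebra.algebraMap_eq_smul_one]
    apply hv.2
    -- From `q(G) v = 0`, symmetry gives `q(μ) ⟪v, e⟫ = 0` for each eigenvector `e`, and `q(μ) ≠ 0`.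
    apply eq_zero_of_orthogonal_eigen hG hc
    intro μ e he
    by_cases e0 : e = 0
    · simp [e0]
    have h1 := inner_aeval hG q v e
    rw [hqv, inner_zero_left, aeval_of_eigen he, inner_smul_right] at h1
    exact (mul_eq_zero.mp h1.symm).resolve_left (hq μ e e0 he)
  · rw [spectrum.mem_resolventSet_iff, ← IsUnit.neg_iff] at h
    rw [hqT]
    convert h using 1
    simp [add_comm]

end Algebra

/-! ### The symbol of the Kalman operator and its degree -/

section Symbol

variable {n m : ℕ}

/-- The matrix pencil `X + μ Y`, with `μ` the indeterminate. -/
noncomputable def pencil (D A : Matrix (Fin n) (Fin n) ℝ) : Matrix (Fin n) (Fin n) ℝ[X] :=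
  D.map C + (X : ℝ[X]) • A.map C

/-- The `j`-th block of the symbol of the adjoint Kalman operator composed with the inverse of
`M ^ (n - 1)`, as a polynomial in the inverse of `M`. -/
noncomputable def kalmanBlock (D A : Matrix (Fin n) (Fin n) ℝ) (B : Matrix (Fin n) (Fin m) ℝ)
    (j : ℕ) : Matrix (Fin m) (Fin n) ℝ[X] :=
  Bᵀ.map C * (pencil Dᵀ Aᵀ ^ (n - 1 - j) * (X ^ j : ℝ[X]) • (1 : Matrix (Fin n) (Fin n) ℝ[X]))

/-- The symbol of the adjoint Kalman operator composed with the inverse of `M ^ (n - 1)`, as a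
polynomial in the inverse of `M`. -/
noncomputable def kalmanSymbol (D A : Matrix (Fin n) (Fin n) ℝ) (B : Matrix (Fin n) (Fin m) ℝ) :
    Matrix (Fin n × Fin m) (Fin n) ℝ[X] :=
  Matrix.of fun p l => kalmanBlock D A B p.1 p.2 l

lemma natDegree_pencil_pow_le (D A : Matrix (Fin n) (Fin n) ℝ) (q : ℕ) (i j : Fin n) :
    ((pencil D A ^ q) i j).natDegree ≤ q := by
  induction q generalizing i j with
  | zero =>
    rw [pow_zero, Matrix.one_apply]
    split_ifs <;> simp
  | succ q ih =>
    rw [pow_succ, Matrix.mul_apply]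
    refine natDegree_sum_le_of_forall_le _ _ fun l _ => ?_
    refine natDegree_mul_le_of_le (ih i l) ?_
    simp only [pencil, Matrix.add_apply, Matrix.map_apply, Matrix.smul_apply, smul_eq_mul]
    compute_degree

/-- In block `j` the pencil power contributes degree at most `n-1-j` and the factor `X^j`
contributes `j`. -/
lemma natDegree_kalmanSymbol_le (D A : Matrix (Fin n) (Fin n) ℝ) (B : Matrix (Fin n) (Fin m) ℝ)
    (p : Fin n × Fin m) (l : Fin n) : (kalmanSymbol D A B p l).natDegree ≤ n - 1 := by
  simp only [kalmanSymbol, Matrix.of_apply, kalmanBlock, Matrix.mul_apply]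
  refine natDegree_sum_le_of_forall_le _ _ fun i _ => ?_
  rw [Matrix.map_apply]
  refine (natDegree_C_mul_le _ _).trans ?_
  refine natDegree_sum_le_of_forall_le _ _ fun j _ => ?_
  have h1 := natDegree_pencil_pow_le Dᵀ Aᵀ (n - 1 - (p.1 : ℕ)) i j
  have h2 : (((X ^ (p.1 : ℕ) : ℝ[X]) • (1 : Matrix (Fin n) (Fin n) ℝ[X])) j l).natDegree
      ≤ (p.1 : ℕ) := by
    rw [Matrix.smul_apply, Matrix.one_apply]
    split_ifs <;> simp
  have := natDegree_mul_le_of_le h1 h2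
  have := p.1.isLt
  omega

lemma natDegree_det_le {P : Matrix (Fin n) (Fin n) ℝ[X]} {k : ℕ}
    (h : ∀ i j, (P i j).natDegree ≤ k) : P.det.natDegree ≤ n * k := by
  rw [Matrix.det_apply]
  refine natDegree_sum_le_of_forall_le _ _ fun σ _ => ?_
  refine (natDegree_smul_le _ _).trans ((natDegree_prod_le _ _).trans ?_)
  refine (Finset.sum_le_sum fun i _ => h (σ i) i).trans ?_
  simp

lemma natDegree_det_gram_kalmanSymbol_le (D A : Matrix (Fin n) (Fin n) ℝ)
    (B : Matrix (Fin n) (Fin m) ℝ) :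
    ((kalmanSymbol D A B)ᵀ * kalmanSymbol D A B).det.natDegree ≤ n * (2 * (n - 1)) := by
  refine natDegree_det_le fun i j => ?_
  rw [Matrix.mul_apply]
  refine natDegree_sum_le_of_forall_le _ _ fun p _ => ?_
  refine (natDegree_mul_le_of_le (natDegree_kalmanSymbol_le D A B p i)
    (natDegree_kalmanSymbol_le D A B p j)).trans (by omega)

end Symbol

/-! ### Kalman estimates from the inverse of `M` -/

section Graphs

variable {d : Degeneracy} {a : ℝ → ℝ} {G : L2 →L[ℝ] L2}
variable {ι κ : Type} [Fintype ι] [Fintype κ] {n m : ℕ}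

lemma isMPow_iff (hM : ∀ u f, IsM d a u f ↔ u = G f) (k : ℕ) (u f : L2) :
    IsMPow d a k u f ↔ u = aeval G (X ^ k : ℝ[X]) f := by
  induction k generalizing f with
  | zero => simp [IsMPow, eq_comm]
  | succ k ih =>
    simp only [IsMPow, ih, hM]
    rw [pow_succ, map_mul, aeval_X]
    simp

lemma isMPowVec_iff [DecidableEq ι] (hM : ∀ u f, IsM d a u f ↔ u = G f) (k : ℕ) (u w : L2Vec ι) :
    IsMPowVec d a k u w ↔ u = polyAct G ((X ^ k : ℝ[X]) • (1 : Matrix ι ι ℝ[X])) w := by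
  simp only [IsMPowVec, isMPow_iff hM]
  constructor
  · intro h
    ext1 i
    rw [polyAct_smul_one_apply, h]
  · intro h i
    rw [h, polyAct_smul_one_apply]

lemma matAct_eq_polyAct (P : Matrix κ ι ℝ) (u : L2Vec ι) :
    matAct P u = polyAct G (P.map C) u := by
  ext1 i
  rw [polyAct_apply]
  simp [matAct, Algebra.algebraMap_eq_smul_one]

/-- If `φ = G η` then `M φ = η`, so `D M + A` becomes the bounded operator `D + G A` acting on `η`.
-/
lemma isL_iff (hM : ∀ u f, IsM d a u f ↔ u = G f) (D A : Matrix (Fin n) (Fin n) ℝ)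
    (φ ψ : L2Vec (Fin n)) :
    IsL d a D A φ ψ ↔ ∃ η, φ = polyAct G ((X : ℝ[X]) • (1 : Matrix (Fin n) (Fin n) ℝ[X])) η ∧
      ψ = polyAct G (pencil D A) η := by
  simp only [IsL, isMPowVec_iff hM, pow_one, matAct_eq_polyAct (G := G)]
  refine exists_congr fun η => and_congr_right fun h => ?_
  rw [h, pencil, polyAct_add, ← polyAct_mul, Matrix.mul_smul, Matrix.mul_one]

/-- Each factor of `L` consumes one factor of `G`, which commutes with the pencil; injectivity of
`G` makes the preimage unique. -/
lemma isLPow_iff (hM : ∀ u f, IsM d a u f ↔ u = G f) (hinj : Function.Injective G)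
    (D A : Matrix (Fin n) (Fin n) ℝ) (q : ℕ) (η ψ : L2Vec (Fin n)) :
    IsLPow d a D A q (polyAct G ((X ^ q : ℝ[X]) • (1 : Matrix (Fin n) (Fin n) ℝ[X])) η) ψ ↔
      ψ = polyAct G (pencil D A ^ q) η := by
  induction q generalizing η ψ with
  | zero => simp [IsLPow]
  | succ q ih =>
    simp only [IsLPow]
    rw [pow_succ, polyAct_smul_one_mul]
    have hX : Function.Injective
        (polyAct G ((X : ℝ[X]) • (1 : Matrix (Fin n) (Fin n) ℝ[X]))) := by
      simpa using polyAct_X_pow_injective (ι := Fin n) hinj 1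
    rw [pow_succ', polyAct_mul]
    simp only [ih, exists_eq_left, isL_iff hM]
    rw [polyAct_comm]
    constructor
    · rintro ⟨ξ, h1, h2⟩
      rw [h2, hX h1]
    · intro h
      exact ⟨_, rfl, h⟩

lemma inner_kalmanSymbol (hG : (G : L2 →ₗ[ℝ] L2).IsSymmetric) (D A : Matrix (Fin n) (Fin n) ℝ)
    (B : Matrix (Fin n) (Fin m) ℝ) (u : L2Vec (Fin n × Fin m)) (η : L2Vec (Fin n)) :
    ∑ j : Fin n, inner ℝ (matAct B (block u j)) (polyAct G (pencil Dᵀ Aᵀ ^ (n - 1 - (j : ℕ)))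
      (polyAct G ((X ^ (j : ℕ) : ℝ[X]) • (1 : Matrix (Fin n) (Fin n) ℝ[X])) η)) =
      inner ℝ u (polyAct G (kalmanSymbol D A B) η) := by
  have h (j : Fin n) : inner ℝ (matAct B (block u j))
      (polyAct G (pencil Dᵀ Aᵀ ^ (n - 1 - (j : ℕ)))
        (polyAct G ((X ^ (j : ℕ) : ℝ[X]) • (1 : Matrix (Fin n) (Fin n) ℝ[X])) η)) =
      ∑ i : Fin m, inner ℝ (u (j, i)) (polyAct G (kalmanSymbol D A B) η (j, i)) := by
    rw [matAct_eq_polyAct (G := G), inner_polyAct hG, ← polyAct_mul, ← polyAct_mul, Matrix.mul_assoc,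
      ← Matrix.transpose_map, PiLp.inner_apply]
    simp only [polyAct_apply, kalmanSymbol, kalmanBlock, Matrix.of_apply, block]
  rw [Finset.sum_congr rfl fun j _ => h j, PiLp.inner_apply, Fintype.sum_prod_type]

lemma exists_of_mem_smoothDomain (hM : ∀ u f, IsM d a u f ↔ u = G f) (k : ℕ) {φ : L2Vec ι}
    [DecidableEq ι] (h : ∀ i, φ i ∈ smoothDomain d a) :
    ∃ η, φ = polyAct G ((X ^ k : ℝ[X]) • (1 : Matrix ι ι ℝ[X])) η := by
  choose η hη using fun i => h i k
  exact ⟨WithLp.toLp 2 η, (isMPowVec_iff hM k _ _).mp hη⟩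

lemma eigen_mem_smoothDomain (hM : ∀ u f, IsM d a u f ↔ u = G f) (hinj : Function.Injective G)
    {μ : ℝ} {e : L2} (he : G e = μ • e) : e ∈ smoothDomain d a := by
  intro p
  simp only [isMPow_iff hM]
  by_cases e0 : e = 0
  · exact ⟨0, by simp [e0]⟩
  have hμ : μ ≠ 0 := by
    rintro rfl
    exact e0 (hinj (by simpa using he))
  refine ⟨(μ ^ p)⁻¹ • e, ?_⟩
  rw [map_smul, aeval_of_eigen he, smul_smul]
  simp [hμ]

/-- The weak formulation collapses to an equation between bounded operators. Every test vector is
`G^{n-1} η`, so moving the polynomials across the inner product tests the difference of the two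
sides against `η`. Vectors `η` with a single nonzero entry, an eigenvector of `G`, are already
enough to make that difference vanish. -/
lemma isKalman_iff (hM : ∀ u f, IsM d a u f ↔ u = G f) (hinj : Function.Injective G)
    (hG : (G : L2 →ₗ[ℝ] L2).IsSymmetric) (hc : IsCompactOperator G)
    (D A : Matrix (Fin n) (Fin n) ℝ) (B : Matrix (Fin n) (Fin m) ℝ)
    (u : L2Vec (Fin n × Fin m)) (f : L2Vec (Fin n)) :
    IsKalman d a D A B u f ↔
      polyAct G ((X ^ (n - 1) : ℝ[X]) • (1 : Matrix (Fin n) (Fin n) ℝ[X])) f =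
        polyAct G (kalmanSymbol D A B)ᵀ u := by
  have hψ (η : L2Vec (Fin n)) (j : Fin n) (ψ : L2Vec (Fin n)) :
      IsLPow d a Dᵀ Aᵀ (n - 1 - (j : ℕ))
        (polyAct G ((X ^ (n - 1) : ℝ[X]) • (1 : Matrix (Fin n) (Fin n) ℝ[X])) η) ψ ↔
      ψ = polyAct G (pencil Dᵀ Aᵀ ^ (n - 1 - (j : ℕ)))
        (polyAct G ((X ^ (j : ℕ) : ℝ[X]) • (1 : Matrix (Fin n) (Fin n) ℝ[X])) η) := by
    -- Of the `n-1` factors of `G`, the power of `L*` uses `n-1-j`; the remaining `j` give the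
    -- factor `X^j` in the symbol.
    have e : (X ^ (n - 1) : ℝ[X]) = X ^ (n - 1 - (j : ℕ)) * X ^ (j : ℕ) := by
      rw [← pow_add]
      congr 1
      omega
    rw [e, polyAct_smul_one_mul, isLPow_iff hM hinj]
  have key (η : L2Vec (Fin n)) :
      inner ℝ f (polyAct G ((X ^ (n - 1) : ℝ[X]) • (1 : Matrix (Fin n) (Fin n) ℝ[X])) η) -
        inner ℝ u (polyAct G (kalmanSymbol D A B) η) =
      inner ℝ (polyAct G ((X ^ (n - 1) : ℝ[X]) • (1 : Matrix (Fin n) (Fin n) ℝ[X])) f -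
        polyAct G (kalmanSymbol D A B)ᵀ u) η := by
    rw [inner_sub_left, inner_polyAct hG, inner_polyAct hG, Matrix.transpose_transpose,
      Matrix.transpose_smul, Matrix.transpose_one]
  constructor
  · intro h
    rw [← sub_eq_zero]
    ext1 i
    refine eq_zero_of_orthogonal_eigen hG hc fun μ e he => ?_
    have hη : (WithLp.toLp 2 (Pi.single i e) : L2Vec (Fin n)) =
        WithLp.toLp 2 fun l => (Pi.single i 1 : Fin n → ℝ) l • e := by
      ext1 l
      by_cases hl : l = i
      · subst hl; simp
      · simp [hl]
    have h1 := h (polyAct G ((X ^ (n - 1) : ℝ[X]) • (1 : Matrix (Fin n) (Fin n) ℝ[X]))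
      (WithLp.toLp 2 (Pi.single i e))) (fun l => by
        rw [hη, polyAct_of_eigen he]
        refine eigen_mem_smoothDomain hM hinj (μ := μ) ?_
        simp [he, smul_comm μ]) _ (fun j => (hψ _ j _).mpr rfl)
    rw [inner_kalmanSymbol hG, ← sub_eq_zero, key] at h1
    simpa [PiLp.inner_apply, Pi.single_apply, apply_ite] using h1
  · intro h φ hφ ψ hψ'
    obtain ⟨η, rfl⟩ := exists_of_mem_smoothDomain hM (n - 1) hφ
    rw [Finset.sum_congr rfl fun j _ => by rw [(hψ η j (ψ j)).mp (hψ' j)], inner_kalmanSymbol hG,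
      ← sub_eq_zero, key, h, sub_self, inner_zero_left]

lemma isKalman_polyAct (hM : ∀ u f, IsM d a u f ↔ u = G f) (hinj : Function.Injective G)
    (hG : (G : L2 →ₗ[ℝ] L2).IsSymmetric) (hc : IsCompactOperator G)
    (D A : Matrix (Fin n) (Fin n) ℝ) (B : Matrix (Fin n) (Fin m) ℝ)
    (w : L2Vec (Fin n × Fin m)) :
    IsKalman d a D A B
      (polyAct G ((X ^ (n - 1) : ℝ[X]) • (1 : Matrix (Fin n × Fin m) (Fin n × Fin m) ℝ[X])) w)
      (polyAct G (kalmanSymbol D A B)ᵀ w) := by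
  rw [isKalman_iff hM hinj hG hc, polyAct_comm]

lemma isKalmanAdjoint_polyAct (hM : ∀ u f, IsM d a u f ↔ u = G f) (hinj : Function.Injective G)
    (hG : (G : L2 →ₗ[ℝ] L2).IsSymmetric) (hc : IsCompactOperator G)
    (D A : Matrix (Fin n) (Fin n) ℝ) (B : Matrix (Fin n) (Fin m) ℝ) (w : L2Vec (Fin n)) :
    IsKalmanAdjoint d a D A B
      (polyAct G ((X ^ (n - 1) : ℝ[X]) • (1 : Matrix (Fin n) (Fin n) ℝ[X])) w)
      (polyAct G (kalmanSymbol D A B) w) := by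
  intro u f h
  rw [isKalman_iff hM hinj hG hc] at h
  have h1 := congrArg (inner ℝ · w) h
  simpa only [inner_polyAct hG, Matrix.transpose_transpose, Matrix.transpose_smul,
    Matrix.transpose_one] using h1

/-- Testing the adjoint only on `u = G^{n-1} w`, where `𝒦 u = S(G)ᵀ w`, suffices. As `G` is
injective, the identity also shows that `𝒦* φ` is unique. -/
lemma IsKalmanAdjoint.polyAct_eq (hM : ∀ u f, IsM d a u f ↔ u = G f)
    (hinj : Function.Injective G) (hG : (G : L2 →ₗ[ℝ] L2).IsSymmetric)
    (hc : IsCompactOperator G) {D A : Matrix (Fin n) (Fin n) ℝ} {B : Matrix (Fin n) (Fin m) ℝ}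
    {φ : L2Vec (Fin n)} {g : L2Vec (Fin n × Fin m)} (h : IsKalmanAdjoint d a D A B φ g) :
    polyAct G (kalmanSymbol D A B) φ =
      polyAct G ((X ^ (n - 1) : ℝ[X]) • (1 : Matrix (Fin n × Fin m) (Fin n × Fin m) ℝ[X])) g := by
  refine ext_inner_left ℝ fun w => ?_
  have h1 := h _ _ (isKalman_polyAct hM hinj hG hc D A B w)
  simpa only [inner_polyAct hG, Matrix.transpose_transpose, Matrix.transpose_smul,
    Matrix.transpose_one] using h1

/-- If the adjoint of the Kalman operator is injective, then the determinant of the Gram matrix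
of its symbol does not vanish on the eigenvalues of the inverse of `M`. -/
lemma eval_det_gram_ne_zero (hM : ∀ u f, IsM d a u f ↔ u = G f) (hinj : Function.Injective G)
    (hG : (G : L2 →ₗ[ℝ] L2).IsSymmetric) (hc : IsCompactOperator G)
    {D A : Matrix (Fin n) (Fin n) ℝ} {B : Matrix (Fin n) (Fin m) ℝ}
    (hker : ∀ φ : L2Vec (Fin n), IsKalmanAdjoint d a D A B φ 0 → φ = 0)
    {μ : ℝ} {e : L2} (e0 : e ≠ 0) (he : G e = μ • e) :
    (((kalmanSymbol D A B)ᵀ * kalmanSymbol D A B).det).eval μ ≠ 0 := by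
  intro h
  set S := (kalmanSymbol D A B).map (eval μ) with hS
  have hdet : (Sᵀ * S).det = 0 := by
    rw [← coe_evalRingHom, RingHom.map_det] at h
    rw [← h]
    congr 1
    simp [hS, RingHom.mapMatrix_apply, Matrix.map_mul, Matrix.transpose_map, ← coe_evalRingHom]
  -- A real kernel vector of `Sᵀ S` is a kernel vector of `S`. Then `G^{n-1}(c ⊗ e)` is killed by
  -- `𝒦*`, although it is nonzero.
  obtain ⟨c, c0, hc'⟩ := Matrix.exists_mulVec_eq_zero_iff.mpr hdet
  have hSc : S.mulVec c = 0 := by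
    rw [← Matrix.conjTranspose_eq_transpose_of_trivial] at hc'
    rwa [Matrix.conjTranspose_mul_self_mulVec_eq_zero] at hc'
  have hμ : μ ≠ 0 := by
    rintro rfl
    exact e0 (hinj (by simpa using he))
  have h1 := isKalmanAdjoint_polyAct hM hinj hG hc D A B (WithLp.toLp 2 fun i => c i • e)
  rw [polyAct_of_eigen he (kalmanSymbol D A B), ← hS, hSc] at h1
  simp only [Pi.zero_apply, zero_smul] at h1
  have h2 := hker _ h1
  apply c0
  ext i
  have h3 : (WithLp.toLp 2 fun i => c i • e : L2Vec (Fin n)) = 0 :=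
    polyAct_X_pow_injective hinj (n - 1) (h2.trans (map_zero _).symm)
  have h4 : c i • e = 0 := congrArg (fun v : L2Vec (Fin n) => v i) h3
  exact (smul_eq_zero.mp h4).resolve_right e0

/-- The determinant of the Gram matrix has, when evaluated at the operator `G`, a bounded inverse
up to a power of `G`. -/
lemma exists_det_gram_inverse (hM : ∀ u f, IsM d a u f ↔ u = G f) (hinj : Function.Injective G)
    (hG : (G : L2 →ₗ[ℝ] L2).IsSymmetric) (hc : IsCompactOperator G) (hne : ∃ x : L2, x ≠ 0)
    {D A : Matrix (Fin n) (Fin n) ℝ} {B : Matrix (Fin n) (Fin m) ℝ}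
    (hker : ∀ φ : L2Vec (Fin n), IsKalmanAdjoint d a D A B φ 0 → φ = 0) :
    ∃ (r : ℝ[X]) (s : ℕ), s ≤ n * (2 * (n - 1)) ∧ IsUnit (aeval G r) ∧
      ((kalmanSymbol D A B)ᵀ * kalmanSymbol D A B).det = X ^ s * r := by
  set q := ((kalmanSymbol D A B)ᵀ * kalmanSymbol D A B).det with hq
  have hev : ∀ (μ : ℝ) (e : L2), e ≠ 0 → G e = μ • e → q.eval μ ≠ 0 := fun μ e e0 he =>
    eval_det_gram_ne_zero hM hinj hG hc hker e0 he
  -- If `q` were zero, `G` could have no eigenvectors at all, contradicting the spectral theorem on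
  -- a nonzero space.
  have hq0 : q ≠ 0 := by
    intro h0
    obtain ⟨x, hx⟩ := hne
    refine hx (eq_zero_of_orthogonal_eigen hG hc fun μ e he => ?_)
    by_cases e0 : e = 0
    · simp [e0]
    · exact absurd (by rw [h0, eval_zero]) (hev μ e e0 he)
  obtain ⟨r, hr, hr0⟩ := exists_eq_pow_rootMultiplicity_mul_and_not_dvd q hq0 0
  rw [C_0, sub_zero] at hr hr0
  refine ⟨r, q.rootMultiplicity 0, ?_, isUnit_aeval hG hc ?_ ?_, hr⟩
  · exact ((count_roots q).symm.le.trans ((Multiset.count_le_card _ _).trans (card_roots' q))).trans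
      (natDegree_det_gram_kalmanSymbol_le D A B)
  · rw [X_dvd_iff, coeff_zero_eq_eval_zero] at hr0
    exact hr0
  · intro μ e e0 he h0
    refine hev μ e e0 he ?_
    rw [hr, eval_mul, h0, mul_zero]

/-- A bounded operator acting componentwise. -/
noncomputable def diagAct (T : L2 →L[ℝ] L2) : L2Vec ι →L[ℝ] L2Vec ι :=
  (PiLp.continuousLinearEquiv 2 ℝ (fun _ : ι => L2)).symm.toContinuousLinearMap ∘L
    ContinuousLinearMap.pi
      (fun i => T ∘L (PiLp.proj 2 (fun _ : ι => L2) i : _ →L[ℝ] L2))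

lemma diagAct_apply (T : L2 →L[ℝ] L2) (u : L2Vec ι) (i : ι) : diagAct T u i = T (u i) := by
  simp [diagAct]

lemma exists_norm_sq_le (T : L2Vec ι →L[ℝ] L2Vec κ) :
    ∃ C : ℝ, 0 < C ∧ ∀ w, ‖T w‖ ^ 2 ≤ C * ‖w‖ ^ 2 := by
  refine ⟨‖T‖ ^ 2 + 1, by positivity, fun w => ?_⟩
  have h := T.le_opNorm w
  calc ‖T w‖ ^ 2 ≤ (‖T‖ * ‖w‖) ^ 2 := by gcongr
    _ ≤ (‖T‖ ^ 2 + 1) * ‖w‖ ^ 2 := by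
      rw [mul_pow]
      nlinarith [sq_nonneg ‖w‖]

/-- The three estimates for the Kalman operator, for an operator `M` which is the inverse of a
compact symmetric injective operator `G`. -/
theorem kalman_estimates (hM : ∀ u f, IsM d a u f ↔ u = G f) (hinj : Function.Injective G)
    (hG : (G : L2 →ₗ[ℝ] L2).IsSymmetric) (hc : IsCompactOperator G) (hne : ∃ x : L2, x ≠ 0)
    (hn : 1 ≤ n) (D A : Matrix (Fin n) (Fin n) ℝ) (B : Matrix (Fin n) (Fin m) ℝ) :
    (∃ C : ℝ, 0 < C ∧ ∀ u w : L2Vec (Fin n × Fin m), IsMPowVec d a (n - 1) u w →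
      (∃ f, IsKalman d a D A B u f) ∧
      ∀ f, IsKalman d a D A B u f → ‖f‖ ^ 2 ≤ C * ‖w‖ ^ 2) ∧
    (∃ C : ℝ, 0 < C ∧ ∀ u w : L2Vec (Fin n), IsMPowVec d a (n - 1) u w →
      (∃ f, IsKalmanAdjoint d a D A B u f) ∧
      ∀ f, IsKalmanAdjoint d a D A B u f → ‖f‖ ^ 2 ≤ C * ‖w‖ ^ 2) ∧
    ((∀ φ : L2Vec (Fin n), IsKalmanAdjoint d a D A B φ 0 → φ = 0) →
      ∃ C : ℝ, 0 < C ∧ ∀ k : ℕ, (2 * n - 1) * (n - 1) ≤ k →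
        ∀ (φ : L2Vec (Fin n)) (g z : L2Vec (Fin n × Fin m)),
          IsKalmanAdjoint d a D A B φ g → IsMPowVec d a k g z →
          (∃ y, IsMPowVec d a (k - (2 * n - 1) * (n - 1)) φ y) ∧
          ∀ y, IsMPowVec d a (k - (2 * n - 1) * (n - 1)) φ y → ‖y‖ ^ 2 ≤ C * ‖z‖ ^ 2) := by
  simp only [isMPowVec_iff hM]
  refine ⟨?_, ?_, fun hker => ?_⟩
  · obtain ⟨C, C0, hC⟩ := exists_norm_sq_le (polyAct G (kalmanSymbol D A B)ᵀ)
    refine ⟨C, C0, ?_⟩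
    rintro u w rfl
    refine ⟨⟨_, isKalman_polyAct hM hinj hG hc D A B w⟩, fun f hf => ?_⟩
    rw [isKalman_iff hM hinj hG hc, polyAct_comm] at hf
    rw [polyAct_X_pow_injective hinj _ hf]
    exact hC w
  · obtain ⟨C, C0, hC⟩ := exists_norm_sq_le (polyAct G (kalmanSymbol D A B))
    refine ⟨C, C0, ?_⟩
    rintro u w rfl
    refine ⟨⟨_, isKalmanAdjoint_polyAct hM hinj hG hc D A B w⟩, fun f hf => ?_⟩
    have h := hf.polyAct_eq hM hinj hG hc
    rw [polyAct_comm] at h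
    rw [← polyAct_X_pow_injective hinj _ h]
    exact hC w
  · obtain ⟨r, s, hs, ⟨R, hR⟩, hr⟩ := exists_det_gram_inverse hM hinj hG hc hne hker
    set S := kalmanSymbol D A B with hS
    set W := (Sᵀ * S).adjugate * Sᵀ with hW
    -- The exponent `e` pads the actual order `s` of the zero of `q` at `0` up to its worst value,
    -- so the bounded operator below, and hence `C`, does not depend on `k`.
    set e := n * (2 * (n - 1)) - s with he
    obtain ⟨C, C0, hC⟩ := exists_norm_sq_le ((diagAct (R⁻¹ : (L2 →L[ℝ] L2)ˣ).val) ∘L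
      polyAct G ((X ^ e : ℝ[X]) • (1 : Matrix (Fin n) (Fin n) ℝ[X])) ∘L polyAct G W)
    refine ⟨C, C0, ?_⟩
    rintro k hk φ _ z hφ rfl
    have h1 := congrArg (polyAct G W) (hφ.polyAct_eq hM hinj hG hc)
    rw [← polyAct_mul, ← polyAct_smul_one_mul, polyAct_comm, hW, Matrix.mul_assoc,
      Matrix.adjugate_mul, hr, ← hW, ← pow_add] at h1
    have hRr (x : L2) : aeval G r ((R⁻¹ : (L2 →L[ℝ] L2)ˣ).val x) = x := by
      rw [← hR, ← mul_apply_eq_comp, Units.mul_inv]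
      rfl
    have hr_inj : Function.Injective (aeval G r) := by
      rw [← hR]
      exact Function.LeftInverse.injective (g := (R⁻¹ : (L2 →L[ℝ] L2)ˣ).val) fun x => by
        rw [← mul_apply_eq_comp, Units.inv_mul]
        rfl
    have hcomm (p q : ℝ[X]) (x : L2) : aeval G p (aeval G q x) = aeval G (p * q) x := by
      rw [map_mul]
      rfl
    have h2 : φ = polyAct G
        ((X ^ (k - (2 * n - 1) * (n - 1)) : ℝ[X]) • (1 : Matrix (Fin n) (Fin n) ℝ[X]))
        (((diagAct (R⁻¹ : (L2 →L[ℝ] L2)ˣ).val) ∘L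
          polyAct G ((X ^ e : ℝ[X]) • (1 : Matrix (Fin n) (Fin n) ℝ[X])) ∘L polyAct G W) z) := by
      ext1 i
      have h3 := congrArg (fun v : L2Vec (Fin n) => v i) h1
      simp only [polyAct_smul_one_apply] at h3
      rw [polyAct_smul_one_apply]
      simp only [ContinuousLinearMap.comp_apply, diagAct_apply, polyAct_smul_one_apply]
      rw [← hcomm] at h3
      apply hr_inj
      apply aeval_X_pow_injective hinj s
      -- After cancelling `r(G)` against its inverse, it remains to match the powers of `G`: `n-1+k
      -- = s + (k - (2n-1)(n-1)) + e`.
      rw [h3, hcomm r, mul_comm r, ← hcomm _ r, hRr, hcomm, hcomm, ← pow_add, ← pow_add]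
      congr 3
      obtain ⟨l, rfl⟩ := Nat.exists_eq_add_of_le' hn
      have e1 : (2 * (l + 1) - 1) * (l + 1 - 1) + l = (l + 1) * (2 * (l + 1 - 1)) := by
        simp only [Nat.add_sub_cancel, show 2 * (l + 1) - 1 = 2 * l + 1 by omega]
        ring
      simp only [Nat.add_sub_cancel] at *
      omega
    refine ⟨⟨_, h2⟩, fun y hy => ?_⟩
    rw [polyAct_X_pow_injective hinj _ (hy.symm.trans h2)]
    exact hC z

end Graphs

end DegenerateKalman

namespace DegenerateKalman

open Filter Topology

/-! ### Hilbert-Schmidt operators are compact -/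

section HilbertSchmidt

variable {E F : Type*} [NormedAddCommGroup E] [InnerProductSpace ℝ E]
  [NormedAddCommGroup F] [InnerProductSpace ℝ F] {ι : Type*}

/-- Cauchy-Schwarz followed by Bessel's inequality; it bounds the difference of two finite-rank
truncations of `T`. -/
lemma norm_sum_inner_smul_le {v : ι → E} (hv : Orthonormal ℝ v) (T : E →L[ℝ] F) (t : Finset ι)
    (x : E) :
    ‖∑ i ∈ t, inner ℝ (v i) x • T (v i)‖ ≤ √(∑ i ∈ t, ‖T (v i)‖ ^ 2) * ‖x‖ := by
  calc ‖∑ i ∈ t, inner ℝ (v i) x • T (v i)‖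
      ≤ ∑ i ∈ t, ‖T (v i)‖ * ‖inner ℝ (v i) x‖ := by
        refine (norm_sum_le _ _).trans (Finset.sum_le_sum fun i _ => ?_)
        rw [norm_smul, mul_comm]
    _ ≤ √(∑ i ∈ t, ‖T (v i)‖ ^ 2) * √(∑ i ∈ t, ‖inner ℝ (v i) x‖ ^ 2) :=
        Real.sum_mul_le_sqrt_mul_sqrt _ _ _
    _ ≤ √(∑ i ∈ t, ‖T (v i)‖ ^ 2) * ‖x‖ := by
        gcongr
        rw [← Real.sqrt_sq (norm_nonneg x)]
        exact Real.sqrt_le_sqrt (hv.sum_inner_products_le x)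

/-- A Hilbert-Schmidt operator is compact. -/
lemma isCompactOperator_of_sum_norm_sq_le [CompleteSpace F] (b : HilbertBasis ι ℝ E)
    (T : E →L[ℝ] F) {c : ℝ} (h : ∀ t : Finset ι, ∑ i ∈ t, ‖T (b i)‖ ^ 2 ≤ c) :
    IsCompactOperator T := by
  classical
  have hsum : Summable fun i => ‖T (b i)‖ ^ 2 :=
    summable_of_sum_le (fun i => sq_nonneg _) h
  let S (t : Finset ι) : E →L[ℝ] F :=
    ∑ i ∈ t, (ContinuousLinearMap.toSpanSingleton ℝ (T (b i))) ∘L (innerSL ℝ (b i))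
  have hS (t : Finset ι) (x : E) : S t x = ∑ i ∈ t, inner ℝ (b i) x • T (b i) := by
    simp [S, ContinuousLinearMap.toSpanSingleton_apply]
  have hcompact (t : Finset ι) : IsCompactOperator (S t) := by
    have : S t ∈ compactOperator (RingHom.id ℝ) E F :=
      Submodule.sum_mem _ fun i _ =>
        ((isCompactOperator_id (E := ℝ)).comp_clm (innerSL ℝ (b i))).clm_comp
          (ContinuousLinearMap.toSpanSingleton ℝ (T (b i)))
    exact this
  have hlim (x : E) : Tendsto (fun t => S t x) atTop (𝓝 (T x)) := by
    have h1 : HasSum (fun i => inner ℝ (b i) x • T (b i)) (T x) := by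
      have := (b.hasSum_repr x).mapL T
      simpa [b.repr_apply_apply] using this
    simp only [hS]
    rwa [HasSum, SummationFilter.unconditional_filter] at h1
  refine isCompactOperator_of_tendsto (l := atTop) (F := S) ?_ (Eventually.of_forall hcompact)
  rw [Metric.tendsto_atTop]
  intro ε hε
  obtain ⟨s, hs⟩ := summable_iff_vanishing_norm.mp hsum ((ε / 2) ^ 2) (by positivity)
  refine ⟨s, fun t ht => ?_⟩
  rw [dist_comm, dist_eq_norm]
  refine lt_of_le_of_lt (ContinuousLinearMap.opNorm_le_bound _ (half_pos hε).le fun x => ?_)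
    (half_lt_self hε)
  -- The bound for `T - S t` is the limit of bounds for `S r - S t` with `r ⊇ t`, which involve only
  -- the small tail of the series.
  have h2 : Tendsto (fun r => ‖S r x - S t x‖) atTop (𝓝 ‖T x - S t x‖) :=
    ((hlim x).sub_const _).norm
  refine le_of_tendsto h2 ?_
  filter_upwards [eventually_ge_atTop t] with r hr
  have h3 : S r x - S t x = ∑ i ∈ r \ t, inner ℝ (b i) x • T (b i) := by
    rw [hS, hS, ← Finset.sum_sdiff hr]
    simp
  rw [h3]
  refine (norm_sum_inner_smul_le b.orthonormal T _ x).trans ?_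
  gcongr
  have h4 := hs (r \ t) (Finset.disjoint_of_subset_right ht Finset.sdiff_disjoint)
  rw [Real.norm_of_nonneg (Finset.sum_nonneg fun i _ => sq_nonneg _)] at h4
  exact (Real.sqrt_le_sqrt h4.le).trans (by rw [Real.sqrt_sq (half_pos hε).le])

end HilbertSchmidt

/-! ### Primitives of square-integrable functions -/

section Primitive

/-- The primitive vanishing at `0` of a function in `L²(0,1)`. -/
noncomputable def primitive (f : L2) (x : ℝ) : ℝ :=
  inner ℝ (indicatorConstLp 2 (measurableSet_Ioo : MeasurableSet (Ioo 0 x))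
    (measure_ne_top unitMeasure _) (1 : ℝ)) f

lemma unitMeasure_Ioo {x : ℝ} (hx : x ∈ Icc (0 : ℝ) 1) : unitMeasure.real (Ioo 0 x) = x := by
  rw [Measure.real, Measure.restrict_apply measurableSet_Ioo,
    inter_eq_left.mpr (Ioo_subset_Ioo_right hx.2)]
  simp [hx.1]

lemma intervalIntegrable_coe (f : L2) : IntervalIntegrable f volume 0 1 := by
  rw [intervalIntegrable_iff_integrableOn_Ioo_of_le zero_le_one]
  exact (Lp.memLp f).integrable one_le_two

lemma primitive_eq (f : L2) {x : ℝ} (hx : x ∈ Icc (0 : ℝ) 1) :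
    primitive f x = ∫ t in (0 : ℝ)..x, f t := by
  rw [primitive, L2.inner_indicatorConstLp_one, Measure.restrict_restrict measurableSet_Ioo,
    inter_eq_left.mpr (Ioo_subset_Ioo_right hx.2), intervalIntegral.integral_of_le hx.1,
    integral_Ioc_eq_integral_Ioo]

lemma continuousOn_primitive (f : L2) : ContinuousOn (primitive f) (Icc 0 1) := by
  have h := intervalIntegral.continuousOn_primitive_interval' (intervalIntegrable_coe f)
    (left_mem_uIcc)
  rw [uIcc_of_le zero_le_one] at h
  exact h.congr fun x hx => primitive_eq f hx

lemma primitive_add (f g : L2) (x : ℝ) : primitive (f + g) x = primitive f x + primitive g x :=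
  inner_add_right _ _ _

lemma primitive_smul (c : ℝ) (f : L2) (x : ℝ) : primitive (c • f) x = c * primitive f x :=
  inner_smul_right _ _ _

lemma primitive_indicator {E : Set ℝ} (hE : MeasurableSet E) (x : ℝ) :
    primitive (indicatorConstLp 2 hE (measure_ne_top unitMeasure _) 1) x =
      unitMeasure.real (Ioo 0 x ∩ E) :=
  L2.real_inner_indicatorConstLp_one_indicatorConstLp_one _ _ _ _

lemma norm_indicator_Ioo_sq {x : ℝ} (hx : x ∈ Icc (0 : ℝ) 1) :
    ‖(indicatorConstLp 2 (measurableSet_Ioo : MeasurableSet (Ioo 0 x))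
      (measure_ne_top unitMeasure _) (1 : ℝ) : L2)‖ ^ 2 = x := by
  rw [← real_inner_self_eq_norm_sq, L2.real_inner_indicatorConstLp_one_indicatorConstLp_one,
    inter_self, unitMeasure_Ioo hx]

lemma primitive_sq_le (f : L2) {x : ℝ} (hx : x ∈ Icc (0 : ℝ) 1) :
    primitive f x ^ 2 ≤ x * ‖f‖ ^ 2 := by
  nth_rw 2 [← norm_indicator_Ioo_sq hx]
  rw [← mul_pow, ← sq_abs]
  gcongr
  exact abs_real_inner_le_norm _ _

/-- The value at `x` is the inner product with the indicator of `(0,x)`, whose squared norm is `x`;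
this is Bessel's inequality. Divided by `a` and integrated, it bounds the Hilbert-Schmidt norm of
`V`. -/
lemma sum_primitive_sq_le {ι : Type*} {b : ι → L2} (hb : Orthonormal ℝ b) (t : Finset ι) {x : ℝ}
    (hx : x ∈ Icc (0 : ℝ) 1) : ∑ i ∈ t, primitive (b i) x ^ 2 ≤ x := by
  refine le_of_le_of_eq (le_trans (Finset.sum_le_sum fun i _ => ?_)
    (hb.sum_inner_products_le (s := t) _)) (norm_indicator_Ioo_sq hx)
  rw [primitive, real_inner_comm, Real.norm_eq_abs, sq_abs]

end Primitive

/-! ### The weighted Volterra operator and its adjoint -/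

section Weight

/-- A positive continuous function on `(0,1]` for which `x / a(x)` is integrable on `(0,1)`. -/
structure Admissible (a : ℝ → ℝ) : Prop where
  continuousOn : ContinuousOn a (Ioc 0 1)
  pos : ∀ x ∈ Ioc (0 : ℝ) 1, 0 < a x
  integrable : Integrable (fun x => x / a x) unitMeasure

variable {a : ℝ → ℝ}

lemma ae_mem_Ioo : ∀ᵐ x ∂unitMeasure, x ∈ Ioo (0 : ℝ) 1 := ae_restrict_mem measurableSet_Ioo

lemma Admissible.aestronglyMeasurable_div_sqrt (ha : Admissible a) {g : ℝ → ℝ}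
    (hg : ContinuousOn g (Ioo 0 1)) :
    AEStronglyMeasurable (fun x => g x / √(a x)) unitMeasure := by
  refine ContinuousOn.aestronglyMeasurable ?_ measurableSet_Ioo
  exact hg.div (ha.continuousOn.mono Ioo_subset_Ioc_self).sqrt fun x hx =>
    (Real.sqrt_pos.mpr (ha.pos x (Ioo_subset_Ioc_self hx))).ne'

lemma Admissible.div_sqrt_sq (ha : Admissible a) (y : ℝ) {x : ℝ} (hx : x ∈ Ioo (0 : ℝ) 1) :
    (y / √(a x)) ^ 2 = y ^ 2 / a x := by
  rw [div_pow, Real.sq_sqrt (ha.pos x (Ioo_subset_Ioc_self hx)).le]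

lemma Admissible.memLp_primitive (ha : Admissible a) (f : L2) :
    MemLp (fun x => primitive f x / √(a x)) 2 unitMeasure := by
  have hm := ha.aestronglyMeasurable_div_sqrt
    ((continuousOn_primitive f).mono Ioo_subset_Icc_self)
  rw [memLp_two_iff_integrable_sq hm]
  refine (ha.integrable.mul_const (‖f‖ ^ 2)).mono' (hm.pow 2) ?_
  filter_upwards [ae_mem_Ioo] with x hx
  have hp := ha.pos x (Ioo_subset_Ioc_self hx)
  rw [Real.norm_of_nonneg (sq_nonneg _), ha.div_sqrt_sq _ hx, div_mul_eq_mul_div]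
  gcongr
  exact primitive_sq_le f (Ioo_subset_Icc_self hx)

lemma L2_norm_sq_toLp {g : ℝ → ℝ} (hg : MemLp g 2 unitMeasure) :
    ‖(hg.toLp g : L2)‖ ^ 2 = ∫ x, g x ^ 2 ∂unitMeasure := by
  rw [← real_inner_self_eq_norm_sq, L2.inner_def]
  refine integral_congr_ae ?_
  filter_upwards [hg.coeFn_toLp] with x hx
  rw [hx]
  simp [sq]

lemma Admissible.norm_sq_primitive (ha : Admissible a) (f : L2) :
    ‖((ha.memLp_primitive f).toLp _ : L2)‖ ^ 2 = ∫ x, primitive f x ^ 2 / a x ∂unitMeasure := by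
  rw [L2_norm_sq_toLp]
  refine integral_congr_ae ?_
  filter_upwards [ae_mem_Ioo] with x hx
  exact ha.div_sqrt_sq _ hx

lemma Admissible.integrable_primitive_sq (ha : Admissible a) (f : L2) :
    Integrable (fun x => primitive f x ^ 2 / a x) unitMeasure := by
  refine (ha.memLp_primitive f).integrable_sq.congr ?_
  filter_upwards [ae_mem_Ioo] with x hx
  exact ha.div_sqrt_sq _ hx

/-- The operator `f ↦ a^{-1/2} ∫₀ˣ f`. -/
noncomputable def Admissible.volterra (ha : Admissible a) : L2 →L[ℝ] L2 :=
  LinearMap.mkContinuousOfExistsBound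
    { toFun := fun f => (ha.memLp_primitive f).toLp _
      map_add' := fun f g => by
        rw [← MemLp.toLp_add]
        congr 1
        ext x
        simp [primitive_add, add_div]
      map_smul' := fun c f => by
        rw [RingHom.id_apply, ← MemLp.toLp_const_smul]
        congr 1
        ext x
        simp [primitive_smul, mul_div_assoc] }
    ⟨√(∫ x, x / a x ∂unitMeasure), fun f => by
      have h0 : 0 ≤ ∫ x, x / a x ∂unitMeasure := by
        refine integral_nonneg_of_ae ?_
        filter_upwards [ae_mem_Ioo] with x hx
        exact div_nonneg hx.1.le (ha.pos x (Ioo_subset_Ioc_self hx)).le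
      refine abs_le_of_sq_le_sq' ?_ (by positivity) |>.2
      rw [mul_pow, Real.sq_sqrt h0]
      refine (ha.norm_sq_primitive f).trans_le ?_
      rw [← integral_mul_const]
      refine integral_mono_ae (ha.integrable_primitive_sq f) (ha.integrable.mul_const _) ?_
      filter_upwards [ae_mem_Ioo] with x hx
      have hp := ha.pos x (Ioo_subset_Ioc_self hx)
      simp only [div_mul_eq_mul_div]
      gcongr
      exact primitive_sq_le f (Ioo_subset_Icc_self hx)⟩

lemma Admissible.volterra_ae (ha : Admissible a) (f : L2) :
    ha.volterra f =ᵐ[unitMeasure] fun x => primitive f x / √(a x) :=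
  (ha.memLp_primitive f).coeFn_toLp

lemma Admissible.isCompactOperator_volterra (ha : Admissible a) :
    IsCompactOperator ha.volterra := by
  obtain ⟨s, b, -⟩ := exists_hilbertBasis ℝ L2
  refine isCompactOperator_of_sum_norm_sq_le b _ (c := ∫ x, x / a x ∂unitMeasure) fun t => ?_
  have h (i : s) : ‖ha.volterra (b i)‖ ^ 2 = ∫ x, primitive (b i) x ^ 2 / a x ∂unitMeasure :=
    ha.norm_sq_primitive (b i)
  simp only [h]
  rw [← integral_finsetSum _ fun i _ => ha.integrable_primitive_sq (b i)]
  refine integral_mono_ae (integrable_finsetSum _ fun i _ => ha.integrable_primitive_sq (b i))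
    ha.integrable ?_
  filter_upwards [ae_mem_Ioo] with x hx
  have hp := ha.pos x (Ioo_subset_Ioc_self hx)
  simp only [← Finset.sum_div]
  gcongr
  exact sum_primitive_sq_le b.orthonormal t (Ioo_subset_Icc_self hx)

/-- `x / √a` is in `L²` because `x² / a ≤ x / a` on `(0,1)`. This is the integrability that Fubini
needs for the adjoint. -/
lemma Admissible.integrable_mul_div_sqrt (ha : Admissible a) (w : L2) :
    Integrable (fun x => x * (w x / √(a x))) unitMeasure := by
  have hm : AEStronglyMeasurable (fun x => x / √(a x)) unitMeasure :=
    ha.aestronglyMeasurable_div_sqrt continuousOn_id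
  have h1 : MemLp (fun x => x / √(a x)) 2 unitMeasure := by
    rw [memLp_two_iff_integrable_sq hm]
    refine ha.integrable.mono' (hm.pow 2) ?_
    filter_upwards [ae_mem_Ioo] with x hx
    have hp := ha.pos x (Ioo_subset_Ioc_self hx)
    rw [Real.norm_of_nonneg (sq_nonneg _), ha.div_sqrt_sq _ hx]
    gcongr
    nlinarith [hx.1, hx.2]
  refine (h1.integrable_mul (Lp.memLp w)).congr (Eventually.of_forall fun x => ?_)
  simp only [Pi.mul_apply]
  ring

/-- Fubini on the triangle `0 < x < s < 1`. -/
lemma integrable_tail {g : ℝ → ℝ} (hg : AEStronglyMeasurable g unitMeasure)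
    (hi : Integrable (fun x => x * g x) unitMeasure) (E : Set ℝ) :
    Integrable (fun p : ℝ × ℝ => (Ioi p.1).indicator g p.2)
      ((unitMeasure.restrict E).prod unitMeasure) := by
  have hset : MeasurableSet {p : ℝ × ℝ | p.1 < p.2} := measurableSet_lt measurable_fst measurable_snd
  have e : (fun p : ℝ × ℝ => (Ioi p.1).indicator g p.2) =
      {p : ℝ × ℝ | p.1 < p.2}.indicator fun p => g p.2 := by
    ext p
    simp [indicator_apply]
  have hm : AEStronglyMeasurable (fun p : ℝ × ℝ => (Ioi p.1).indicator g p.2)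
      ((unitMeasure.restrict E).prod unitMeasure) := by
    rw [e]
    exact hg.comp_snd.indicator hset
  rw [integrable_prod_iff' hm]
  constructor
  · refine Eventually.of_forall fun s => ?_
    have : (fun x : ℝ => (Ioi x).indicator g s) = (Iio s).indicator fun _ => g s := by
      ext x
      by_cases h : x < s <;> simp [h]
    simp only [this]
    exact (integrable_const _).indicator measurableSet_Iio
  · have h2 := (hi.norm).mono' (f := fun s => ∫ x, ‖(Ioi x).indicator g s‖
      ∂(unitMeasure.restrict E)) hm.norm.prod_swap.integral_prod_right' ?_
    · exact h2
    filter_upwards [ae_mem_Ioo] with s hs'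
    have h3 : (fun x : ℝ => ‖(Ioi x).indicator g s‖) = (Iio s).indicator fun _ => ‖g s‖ := by
      ext x
      by_cases h : x < s <;> simp [h]
    rw [h3, integral_indicator measurableSet_Iio, setIntegral_const, norm_smul, norm_norm,
      norm_mul, Real.norm_of_nonneg hs'.1.le, Real.norm_of_nonneg measureReal_nonneg]
    gcongr
    calc (unitMeasure.restrict E).real (Iio s) ≤ unitMeasure.real (Iio s) :=
          ENNReal.toReal_mono (measure_ne_top _ _) (Measure.restrict_apply_le _ _)
      _ = unitMeasure.real (Ioo 0 s) := by
          rw [Measure.real, Measure.real, Measure.restrict_apply measurableSet_Iio,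
            Measure.restrict_apply measurableSet_Ioo]
          congr 2
          ext x
          simp only [mem_inter_iff, mem_Iio, mem_Ioo]
          tauto
      _ = s := unitMeasure_Ioo (Ioo_subset_Icc_self hs')

lemma setIntegral_Ioi_unitMeasure (g : ℝ → ℝ) {x : ℝ} (hx : x ∈ Icc (0 : ℝ) 1) :
    ∫ s, (Ioi x).indicator g s ∂unitMeasure = ∫ s in x..1, g s := by
  rw [integral_indicator measurableSet_Ioi, Measure.restrict_restrict measurableSet_Ioi,
    intervalIntegral.integral_of_le hx.2, integral_Ioc_eq_integral_Ioo]
  congr 2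
  ext s
  simp only [mem_inter_iff, mem_Ioi, mem_Ioo]
  exact ⟨fun h => ⟨h.1, h.2.2⟩, fun h => ⟨h.1, hx.1.trans_lt h.1, h.2⟩⟩

lemma integrable_integral_tail {g : ℝ → ℝ} (hg : AEStronglyMeasurable g unitMeasure)
    (hi : Integrable (fun x => x * g x) unitMeasure) :
    Integrable (fun x => ∫ s in x..1, g s) unitMeasure := by
  have h := (integrable_tail hg hi univ).integral_prod_left
  rw [Measure.restrict_univ] at h
  refine h.congr ?_
  filter_upwards [ae_mem_Ioo] with x hx
  exact setIntegral_Ioi_unitMeasure g (Ioo_subset_Icc_self hx)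

lemma setIntegral_integral_tail {g : ℝ → ℝ} (hg : AEStronglyMeasurable g unitMeasure)
    (hi : Integrable (fun x => x * g x) unitMeasure) {E : Set ℝ} (hE : MeasurableSet E) :
    ∫ x in E, (∫ s in x..1, g s) ∂unitMeasure =
      ∫ s, g s * unitMeasure.real (Ioo 0 s ∩ E) ∂unitMeasure := by
  calc ∫ x in E, (∫ s in x..1, g s) ∂unitMeasure
      = ∫ x in E, (∫ s, (Ioi x).indicator g s ∂unitMeasure) ∂unitMeasure := by
        refine integral_congr_ae (ae_restrict_of_ae ?_)
        filter_upwards [ae_mem_Ioo] with x hx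
        exact (setIntegral_Ioi_unitMeasure g (Ioo_subset_Icc_self hx)).symm
    _ = ∫ s, (∫ x in E, (Ioi x).indicator g s ∂unitMeasure) ∂unitMeasure :=
        integral_integral_swap (f := fun x s => (Ioi x).indicator g s) (integrable_tail hg hi E)
    _ = _ := by
        refine integral_congr_ae ?_
        filter_upwards [ae_mem_Ioo] with s hs
        have h : (fun x : ℝ => (Ioi x).indicator g s) = (Iio s).indicator fun _ => g s := by
          ext x
          by_cases h : x < s <;> simp [h]
        rw [h, integral_indicator measurableSet_Iio, setIntegral_const, smul_eq_mul, mul_comm]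
        congr 1
        rw [Measure.real, Measure.real, Measure.restrict_apply measurableSet_Iio,
          Measure.restrict_apply (measurableSet_Iio.inter hE),
          Measure.restrict_apply (measurableSet_Ioo.inter hE)]
        congr 2
        ext x
        simp only [mem_inter_iff, mem_Iio, mem_Ioo]
        tauto

/-- The adjoint of the operator `f ↦ a^{-1/2} ∫₀ˣ f` is `w ↦ ∫ₓ¹ a^{-1/2} w`. -/
lemma Admissible.adjoint_volterra_ae (ha : Admissible a) (w : L2) :
    ContinuousLinearMap.adjoint ha.volterra w =ᵐ[unitMeasure]
      fun x => ∫ s in x..1, w s / √(a s) := by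
  have hg : AEStronglyMeasurable (fun s => w s / √(a s)) unitMeasure := by
    have := (Lp.aestronglyMeasurable w).mul
      (ha.aestronglyMeasurable_div_sqrt (continuousOn_const (c := (1 : ℝ))))
    refine this.congr (Eventually.of_forall fun x => ?_)
    simp [div_eq_mul_inv]
  have hi := ha.integrable_mul_div_sqrt w
  -- Both sides are compared through their integrals over measurable sets `E`, that is, by pairing
  -- `V* w` with the indicator of `E`.
  refine Integrable.ae_eq_of_forall_setIntegral_eq _ _
    ((Lp.memLp _).integrable one_le_two) (integrable_integral_tail hg hi) fun E hE _ => ?_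
  rw [setIntegral_integral_tail hg hi hE,
    ← L2.inner_indicatorConstLp_one (𝕜 := ℝ) hE (measure_ne_top unitMeasure _),
    ContinuousLinearMap.adjoint_inner_right, L2.inner_def]
  refine integral_congr_ae ?_
  filter_upwards [ha.volterra_ae (indicatorConstLp 2 hE (measure_ne_top unitMeasure _) 1)]
    with s hs
  rw [hs, primitive_indicator hE]
  simp
  ring

end Weight

end DegenerateKalman

namespace DegenerateKalman

open Filter Topology

/-! ### Weak derivatives on the unit interval -/

section WeakDerivative

lemma absolutelyContinuousOnInterval_primitive (f : L2) :
    AbsolutelyContinuousOnInterval (primitive f) 0 1 := by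
  have h := (intervalIntegrable_coe f).absolutelyContinuousOnInterval_intervalIntegral
    (c := 0) left_mem_uIcc
  rw [absolutelyContinuousOnInterval_iff] at h ⊢
  intro ε hε
  obtain ⟨δ, hδ, hd⟩ := h ε hε
  refine ⟨δ, hδ, fun E hE hlt => ?_⟩
  refine lt_of_eq_of_lt (Finset.sum_congr rfl fun i hi => ?_) (hd E hE hlt)
  have h1 := hE.1 i hi
  rw [uIcc_of_le zero_le_one] at h1
  rw [primitive_eq f h1.1, primitive_eq f h1.2]

lemma ae_deriv_primitive (f : L2) : ∀ᵐ x, x ∈ Ioo (0 : ℝ) 1 → deriv (primitive f) x = f x := by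
  filter_upwards [(intervalIntegrable_coe f).ae_hasDerivAt_integral] with x hx hx1
  have h2 : x ∈ uIcc (0 : ℝ) 1 := by
    rw [uIcc_of_le zero_le_one]
    exact Ioo_subset_Icc_self hx1
  refine ((hx h2 0 left_mem_uIcc).congr_of_eventuallyEq ?_).deriv
  filter_upwards [isOpen_Ioo.mem_nhds hx1] with y hy
  exact primitive_eq f (Ioo_subset_Icc_self hy)

lemma apply_zero_one_of_tsupport_subset {φ : ℝ → ℝ} (h : tsupport φ ⊆ Ioo 0 1) :
    φ 0 = 0 ∧ φ 1 = 0 :=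
  ⟨image_eq_zero_of_notMem_tsupport fun h0 => lt_irrefl _ (h h0).1,
    image_eq_zero_of_notMem_tsupport fun h1 => lt_irrefl _ (h h1).2⟩

/-- Integration by parts against a test function. -/
lemma integral_primitive_mul_deriv (f : L2) (c : ℝ) {φ : ℝ → ℝ} (hφ : ContDiff ℝ ∞ φ)
    (h : tsupport φ ⊆ Ioo 0 1) :
    ∫ x in Ioo (0 : ℝ) 1, (primitive f x - c) * deriv φ x = - ∫ x in Ioo (0 : ℝ) 1, f x * φ x := by
  obtain ⟨h0, h1⟩ := apply_zero_one_of_tsupport_subset h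
  have hφ' : AbsolutelyContinuousOnInterval φ 0 1 :=
    (hφ.of_le (by exact_mod_cast le_top)).contDiffOn.absolutelyContinuousOnInterval
  have hc : AbsolutelyContinuousOnInterval (fun _ : ℝ => c) 0 1 :=
    contDiffOn_const.absolutelyContinuousOnInterval
  have hF := (absolutelyContinuousOnInterval_primitive f).sub hc
  have key := hF.integral_mul_deriv_eq_deriv_mul hφ'
  rw [h0, h1, mul_zero, mul_zero, sub_zero, zero_sub, intervalIntegral.integral_of_le zero_le_one,
    intervalIntegral.integral_of_le zero_le_one, integral_Ioc_eq_integral_Ioo,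
    integral_Ioc_eq_integral_Ioo] at key
  refine key.trans (congrArg _ (setIntegral_congr_ae measurableSet_Ioo ?_))
  filter_upwards [ae_deriv_primitive f] with x hx hx1
  rw [← hx hx1]
  congr 1
  exact deriv_sub_const c

lemma memLp_primitive_sub (f : L2) (c : ℝ) :
    MemLp (fun x => primitive f x - c) 2 unitMeasure := by
  have hc : ContinuousOn (fun x => primitive f x - c) (Icc 0 1) :=
    (continuousOn_primitive f).sub continuousOn_const
  obtain ⟨C, hC⟩ := isCompact_Icc.exists_bound_of_continuousOn hc
  refine MemLp.of_bound ((hc.mono Ioo_subset_Icc_self).aestronglyMeasurable measurableSet_Ioo) C ?_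
  filter_upwards [ae_mem_Ioo] with x hx
  exact hC x (Ioo_subset_Icc_self hx)

lemma hasH1Deriv_of_eqOn (f : L2) (c : ℝ) {p : ℝ → ℝ}
    (hp : ∀ x ∈ Ioo (0 : ℝ) 1, p x = primitive f x - c) : HasH1Deriv p f := by
  refine ⟨(memLp_primitive_sub f c).ae_eq ?_, Lp.memLp f, fun φ hφ _ h => ?_⟩
  · filter_upwards [ae_mem_Ioo] with x hx
    exact (hp x hx).symm
  · rw [← integral_primitive_mul_deriv f c hφ h]
    exact setIntegral_congr_fun measurableSet_Ioo fun x hx => by simp only [hp x hx]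

/-- A test function of vanishing integral is the derivative of a test function. -/
lemma exists_deriv_eq_of_integral_eq_zero {ψ : ℝ → ℝ} (hψ : ContDiff ℝ ∞ ψ)
    (hc : HasCompactSupport ψ) (hs : tsupport ψ ⊆ Ioo 0 1) (h0 : ∫ x, ψ x = 0) :
    ∃ φ : ℝ → ℝ, ContDiff ℝ ∞ φ ∧ HasCompactSupport φ ∧ tsupport φ ⊆ Ioo 0 1 ∧ deriv φ = ψ := by
  have hcomp : IsCompact (tsupport ψ) := hc
  -- The compact support leaves a margin at both endpoints. The primitive from `α` vanishes left of
  -- `α`, and right of `β` it equals the total integral, which is zero.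
  obtain ⟨α, β, hα, hβ, hsub⟩ : ∃ α β : ℝ, 0 < α ∧ β < 1 ∧ tsupport ψ ⊆ Ioo α β := by
    rcases (tsupport ψ).eq_empty_or_nonempty with he | hne
    · exact ⟨1 / 2, 1 / 2, by norm_num, by norm_num, by simp [he]⟩
    · obtain ⟨α, hα, hα'⟩ := hcomp.exists_isLeast hne
      obtain ⟨β, hβ, hβ'⟩ := hcomp.exists_isGreatest hne
      have h1 := (hs hα).1
      have h2 := (hs hβ).2
      refine ⟨α / 2, (β + 1) / 2, by linarith, by linarith, fun x hx => ⟨?_, ?_⟩⟩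
      · linarith [hα' hx]
      · linarith [hβ' hx]
  have hzero {x : ℝ} (hx : x ∉ Ioo α β) : ψ x = 0 :=
    image_eq_zero_of_notMem_tsupport fun h => hx (hsub h)
  have hcont := hψ.continuous
  have hderiv (x : ℝ) : HasDerivAt (fun x => ∫ t in α..x, ψ t) (ψ x) x :=
    intervalIntegral.integral_hasDerivAt_right (hcont.intervalIntegrable _ _)
      (hcont.stronglyMeasurableAtFilter _ _) hcont.continuousAt
  have hd : deriv (fun x => ∫ t in α..x, ψ t) = ψ := funext fun x => (hderiv x).deriv
  have hsupp : tsupport (fun x => ∫ t in α..x, ψ t) ⊆ Icc α β := by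
    refine closure_minimal (fun x hx => ?_) isClosed_Icc
    by_contra hx'
    apply hx
    rcases lt_or_ge x α with h | h
    · refine intervalIntegral.integral_zero_ae (Eventually.of_forall fun t ht => hzero fun h' => ?_)
      rw [uIoc_of_ge h.le] at ht
      exact absurd ht.2 (not_le.mpr h'.1)
    · have hβx : β < x := not_le.mp fun h' => hx' ⟨h, h'⟩
      simp only
      rw [intervalIntegral.integral_of_le h, ← h0]
      exact setIntegral_eq_integral_of_forall_compl_eq_zero fun t ht =>
        hzero fun h' => ht ⟨h'.1, h'.2.le.trans hβx.le⟩
  refine ⟨_, ?_, isCompact_Icc.of_isClosed_subset (isClosed_tsupport _) hsupp,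
    hsupp.trans fun x hx => ⟨hα.trans_le hx.1, hx.2.trans_lt hβ⟩, hd⟩
  exact contDiff_infty_iff_deriv.mpr ⟨fun x => (hderiv x).differentiableAt, hd.symm ▸ hψ⟩

lemma exists_test_integral_eq_one : ∃ ρ : ℝ → ℝ, ContDiff ℝ ∞ ρ ∧ HasCompactSupport ρ ∧
    tsupport ρ ⊆ Ioo 0 1 ∧ ∫ x, ρ x = 1 := by
  let b : ContDiffBump (1 / 2 : ℝ) := ⟨1 / 8, 1 / 4, by norm_num, by norm_num⟩
  refine ⟨b.normed volume, b.contDiff_normed, b.hasCompactSupport_normed, ?_, b.integral_normed⟩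
  rw [b.tsupport_normed_eq, Real.closedBall_eq_Icc]
  intro x hx
  have h1 : (1 / 2 : ℝ) - 1 / 4 ≤ x := hx.1
  have h2 : x ≤ (1 / 2 : ℝ) + 1 / 4 := hx.2
  constructor <;> linarith

/-- The lemma of du Bois-Reymond on `(0,1)`. -/
lemma ae_const_of_integral_mul_deriv_eq_zero {h : ℝ → ℝ} (hi : Integrable h unitMeasure)
    (hz : ∀ φ : ℝ → ℝ, ContDiff ℝ ∞ φ → HasCompactSupport φ → tsupport φ ⊆ Ioo 0 1 →
      ∫ x in Ioo (0 : ℝ) 1, h x * deriv φ x = 0) :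
    ∃ c, ∀ᵐ x ∂unitMeasure, h x = c := by
  obtain ⟨ρ, hρ, hρc, hρs, hρ1⟩ := exists_test_integral_eq_one
  have hint {ψ : ℝ → ℝ} (hψ : ContDiff ℝ ∞ ψ) (hψc : HasCompactSupport ψ) :
      Integrable (fun x => h x * ψ x) unitMeasure := by
    obtain ⟨C, hC⟩ := hψ.continuous.bounded_above_of_compact_support hψc
    exact hi.mul_bdd hψ.continuous.aestronglyMeasurable (Eventually.of_forall hC)
  set c := ∫ x in Ioo (0 : ℝ) 1, h x * ρ x with hcdef
  refine ⟨c, ?_⟩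
  have hloc : LocallyIntegrableOn (fun x => h x - c) (Ioo 0 1) volume := by
    have : IntegrableOn (fun x => h x - c) (Ioo 0 1) volume := hi.sub (integrable_const c)
    exact this.locallyIntegrableOn
  have key := isOpen_Ioo.ae_eq_zero_of_integral_contDiff_smul_eq_zero hloc fun ψ hψ hψc hψs => by
    have hint1 : ∀ {θ : ℝ → ℝ}, tsupport θ ⊆ Ioo 0 1 → ∫ x in Ioo (0 : ℝ) 1, θ x = ∫ x, θ x :=
      fun {θ} hθ => setIntegral_eq_integral_of_forall_compl_eq_zero fun x hx =>
        image_eq_zero_of_notMem_tsupport fun h => hx (hθ h)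
    have hsub : tsupport (fun x => ψ x - (∫ y, ψ y) * ρ x) ⊆ Ioo 0 1 := by
      refine (tsupport_sub _ _).trans (union_subset hψs ?_)
      exact (tsupport_mul_subset_right).trans hρs
    have hcd : ContDiff ℝ ∞ (fun x => ψ x - (∫ y, ψ y) * ρ x) := hψ.sub (contDiff_const.mul hρ)
    have hcs : HasCompactSupport (fun x => ψ x - (∫ y, ψ y) * ρ x) :=
      isCompact_Icc.of_isClosed_subset (isClosed_tsupport _)
        (hsub.trans Ioo_subset_Icc_self)
    have hψi : Integrable ψ := hψ.continuous.integrable_of_hasCompactSupport hψc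
    have hρi : Integrable ρ := hρ.continuous.integrable_of_hasCompactSupport hρc
    -- Subtracting `(∫ ψ) ρ` makes the integral vanish, so the difference is an admissible
    -- derivative; the correction accounts for the constant `c = ∫ h ρ`.
    obtain ⟨φ, hφ, hφc, hφs, hφd⟩ := exists_deriv_eq_of_integral_eq_zero hcd hcs hsub (by
      rw [integral_sub hψi (hρi.const_mul _), integral_const_mul, hρ1, mul_one, sub_self])
    have hz' := hz φ hφ hφc hφs
    rw [hφd] at hz'
    have e1 : ∫ x in Ioo (0 : ℝ) 1, h x * ψ x = (∫ y, ψ y) * c := by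
      have e2 : ∀ x, h x * (ψ x - (∫ y, ψ y) * ρ x) =
          h x * ψ x - (∫ y, ψ y) * (h x * ρ x) := fun x => by ring
      simp only [e2] at hz'
      rw [integral_sub (hint hψ hψc) ((hint hρ hρc).const_mul _), integral_const_mul] at hz'
      linarith
    rw [← hint1 ((tsupport_smul_subset_left _ _).trans hψs)]
    have e3 : ∀ x, ψ x • (h x - c) = h x * ψ x - c * ψ x := fun x => by
      rw [smul_eq_mul]
      ring
    simp only [e3]
    rw [integral_sub (hint hψ hψc) (hψi.integrableOn.const_mul _), integral_const_mul, hint1 hψs,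
      e1]
    ring
  rw [ae_restrict_iff' measurableSet_Ioo]
  filter_upwards [key] with x hx hx1
  exact sub_eq_zero.mp (hx hx1)

/-- The difference `primitive f - p` has zero weak derivative, so du Bois-Reymond applies. -/
lemma HasH1Deriv.exists_ae_eq {p : ℝ → ℝ} {f : L2} (h : HasH1Deriv p f) :
    ∃ c, ∀ᵐ x ∂unitMeasure, p x = primitive f x - c := by
  have hF : Integrable (primitive f) unitMeasure := by
    simpa using (memLp_primitive_sub f 0).integrable one_le_two
  have hp := h.1.integrable one_le_two
  obtain ⟨c, hc⟩ := ae_const_of_integral_mul_deriv_eq_zero (hF.sub hp) fun φ hφ hφc hφs => by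
    have hd : Continuous (deriv φ) := hφ.continuous_deriv (by simp)
    obtain ⟨C, hC⟩ := hd.bounded_above_of_compact_support hφc.deriv
    have h1 := integral_primitive_mul_deriv f 0 hφ hφs
    simp only [sub_zero] at h1
    simp only [Pi.sub_apply, sub_mul]
    rw [integral_sub (hF.mul_bdd hd.aestronglyMeasurable (Eventually.of_forall hC))
      (hp.mul_bdd hd.aestronglyMeasurable (Eventually.of_forall hC)), h1, h.2.2 φ hφ hφc hφs,
      sub_self]
  refine ⟨c, ?_⟩
  filter_upwards [hc] with x hx
  simp only [Pi.sub_apply] at hx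
  linarith

end WeakDerivative

end DegenerateKalman

namespace DegenerateKalman

open Filter Topology

/-! ### Solving `(a v')' = f` with `v(1) = 0` -/

section Solution

variable {a : ℝ → ℝ}

/-- The solution of `a v' = ∫₀ˣ f - c` with `v(1) = 0`. -/
noncomputable def sol (a : ℝ → ℝ) (f : L2) (c x : ℝ) : ℝ :=
  -∫ s in x..1, (primitive f s - c) / a s

lemma Admissible.continuousOn_flux (ha : Admissible a) (f : L2) (c : ℝ) :
    ContinuousOn (fun s => (primitive f s - c) / a s) (Ioc 0 1) :=
  (((continuousOn_primitive f).mono Ioc_subset_Icc_self).sub continuousOn_const).div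
    ha.continuousOn fun x hx => (ha.pos x hx).ne'

lemma Admissible.intervalIntegrable_flux (ha : Admissible a) (f : L2) (c : ℝ) {x : ℝ}
    (hx : x ∈ Ioc (0 : ℝ) 1) :
    IntervalIntegrable (fun s => (primitive f s - c) / a s) volume x 1 := by
  refine ContinuousOn.intervalIntegrable ((ha.continuousOn_flux f c).mono ?_)
  rw [uIcc_of_le hx.2]
  exact fun y hy => ⟨hx.1.trans_le hy.1, hy.2⟩

lemma Admissible.hasDerivAt_sol (ha : Admissible a) (f : L2) (c : ℝ) {x : ℝ}
    (hx : x ∈ Ioo (0 : ℝ) 1) :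
    HasDerivAt (sol a f c) ((primitive f x - c) / a x) x := by
  have hc := (ha.continuousOn_flux f c).mono Ioo_subset_Ioc_self
  have h := intervalIntegral.integral_hasDerivAt_left
    (ha.intervalIntegrable_flux f c (Ioo_subset_Ioc_self hx))
    (hc.stronglyMeasurableAtFilter isOpen_Ioo x hx) (hc.continuousAt (isOpen_Ioo.mem_nhds hx))
  have h' := h.neg
  rw [neg_neg] at h'
  exact h'

lemma absolutelyContinuousOnInterval_sol {f : L2} {c x : ℝ}
    (h : IntervalIntegrable (fun s => (primitive f s - c) / a s) volume x 1) :
    AbsolutelyContinuousOnInterval (sol a f c) x 1 := by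
  have h1 := h.absolutelyContinuousOnInterval_intervalIntegral (c := 1) right_mem_uIcc
  convert h1 using 2 with y
  rw [sol, intervalIntegral.integral_symm, neg_neg]

lemma Admissible.sqrt_mul_div (ha : Admissible a) (y : ℝ) {x : ℝ} (hx : x ∈ Ioo (0 : ℝ) 1) :
    √(a x) * (y / a x) = y / √(a x) := by
  have h := ha.pos x (Ioo_subset_Ioc_self hx)
  have h2 := Real.sqrt_pos.mpr h
  rw [mul_div_left_comm, Real.sqrt_div_self', mul_one_div]

/-- The two weights `a^{-1/2}`, one in `w` and one in `V*`, multiply to the `1/a` in `sol`. This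
also gives square integrability of `sol` for free. -/
lemma Admissible.adjoint_volterra_ae_sol (ha : Admissible a) {f w : L2} {c : ℝ}
    (hw : w =ᵐ[unitMeasure] fun x => (primitive f x - c) / √(a x)) :
    ((-ContinuousLinearMap.adjoint ha.volterra w : L2) : ℝ → ℝ) =ᵐ[unitMeasure] sol a f c := by
  have hw' := (ae_restrict_iff' measurableSet_Ioo).mp hw
  filter_upwards [Lp.coeFn_neg (ContinuousLinearMap.adjoint ha.volterra w),
    ha.adjoint_volterra_ae w, ae_mem_Ioo] with x h1 h2 hx
  rw [h1, Pi.neg_apply, h2, sol, intervalIntegral.integral_of_le hx.2.le,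
    intervalIntegral.integral_of_le hx.2.le, integral_Ioc_eq_integral_Ioo,
    integral_Ioc_eq_integral_Ioo]
  congr 1
  refine setIntegral_congr_ae measurableSet_Ioo ?_
  filter_upwards [hw'] with s hs hs1
  have hs2 : s ∈ Ioo (0 : ℝ) 1 := ⟨hx.1.trans hs1.1, hs1.2⟩
  have hp := ha.pos s (Ioo_subset_Ioc_self hs2)
  rw [hs hs2, div_div, Real.mul_self_sqrt hp.le]

/-- The part of `u ∈ D(M)`, `M u = f` common to both degeneracies, for `u` given by `sol`. -/
lemma Admissible.sol_spec (ha : Admissible a) {f w : L2} {c : ℝ}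
    (hw : w =ᵐ[unitMeasure] fun x => (primitive f x - c) / √(a x)) :
    MemLp (sol a f c) 2 unitMeasure ∧
      MemLp (fun x => √(a x) * deriv (sol a f c) x) 2 unitMeasure ∧ sol a f c 1 = 0 ∧
      HasH1Deriv (fun x => a x * deriv (sol a f c) x) f := by
  refine ⟨(Lp.memLp _).ae_eq (ha.adjoint_volterra_ae_sol hw), (Lp.memLp w).ae_eq ?_,
    by simp [sol], hasH1Deriv_of_eqOn f c fun x hx => ?_⟩
  · filter_upwards [hw, ae_mem_Ioo] with x h hx
    rw [h, (ha.hasDerivAt_sol f c hx).deriv, ha.sqrt_mul_div _ hx]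
  · rw [(ha.hasDerivAt_sol f c hx).deriv]
    exact mul_div_cancel₀ _ (ha.pos x (Ioo_subset_Ioc_self hx)).ne'

lemma Admissible.ae_deriv_eq (ha : Admissible a) {v : ℝ → ℝ} {f : L2} {c : ℝ}
    (h : ∀ᵐ x ∂unitMeasure, a x * deriv v x = primitive f x - c) :
    ∀ᵐ x, x ∈ Ioo (0 : ℝ) 1 → deriv v x = (primitive f x - c) / a x := by
  filter_upwards [(ae_restrict_iff' measurableSet_Ioo).mp h] with x hx hx1
  rw [eq_div_iff (ha.pos x (Ioo_subset_Ioc_self hx1)).ne', mul_comm]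
  exact hx hx1

lemma Admissible.eq_sol (ha : Admissible a) {v : ℝ → ℝ} {f : L2} {c : ℝ}
    (h : ∀ᵐ x ∂unitMeasure, a x * deriv v x = primitive f x - c) {x : ℝ} (hx : x ∈ Ico (0 : ℝ) 1)
    (hv : AbsolutelyContinuousOnInterval v x 1) (h1 : v 1 = 0) : v x = sol a f c x := by
  have e := hv.integral_deriv_eq_sub
  rw [h1, zero_sub] at e
  rw [← neg_eq_iff_eq_neg.mpr e, sol, intervalIntegral.integral_of_le hx.2.le,
    intervalIntegral.integral_of_le hx.2.le, integral_Ioc_eq_integral_Ioo,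
    integral_Ioc_eq_integral_Ioo]
  congr 1
  refine setIntegral_congr_ae measurableSet_Ioo ?_
  filter_upwards [ha.ae_deriv_eq h] with s hs hs1
  exact hs ⟨hx.1.trans_lt hs1.1, hs1.2⟩

lemma MemH1a.absolutelyContinuousOnInterval {d : Degeneracy} {v : ℝ → ℝ} (h : MemH1a d a v)
    {x : ℝ} (hx : x ∈ Ioo (0 : ℝ) 1) : AbsolutelyContinuousOnInterval v x 1 := by
  cases d with
  | weak =>
    refine h.2.1.mono (uIcc_subset_uIcc ?_ right_mem_uIcc)
    rw [uIcc_of_le zero_le_one]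
    exact Ioo_subset_Icc_self hx
  | strong => exact h.2.1 x hx

lemma MemH1a.apply_one {d : Degeneracy} {v : ℝ → ℝ} (h : MemH1a d a v) : v 1 = 0 := by
  cases d with
  | weak => exact h.2.2.2.2
  | strong => exact h.2.2.2

lemma MemH1a.memLp_deriv {d : Degeneracy} {v : ℝ → ℝ} (h : MemH1a d a v) :
    MemLp (fun x => √(a x) * deriv v x) 2 unitMeasure := by
  cases d with
  | weak => exact h.2.2.1
  | strong => exact h.2.2.1

/-- Two integrations determine an element of `D(M)` from `M u` up to the flux constant `c`; only the
condition at `0`, specific to each degeneracy, can fix it. -/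
lemma Admissible.exists_eq_sol (ha : Admissible a) {d : Degeneracy} {u f : L2}
    (h : IsM d a u f) : ∃ v c, MemH1a d a v ∧
      (∀ᵐ x ∂unitMeasure, a x * deriv v x = primitive f x - c) ∧ u =ᵐ[unitMeasure] sol a f c ∧
      ∀ x ∈ Ioo (0 : ℝ) 1, v x = sol a f c x := by
  obtain ⟨v, huv, hv, hd⟩ := h
  obtain ⟨c, hc⟩ := hd.exists_ae_eq
  have hs : ∀ x ∈ Ioo (0 : ℝ) 1, v x = sol a f c x := fun x hx =>
    ha.eq_sol hc (Ioo_subset_Ico_self hx) (hv.absolutelyContinuousOnInterval hx) hv.apply_one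
  refine ⟨v, c, hv, hc, ?_, hs⟩
  filter_upwards [huv, ae_mem_Ioo] with x h1 hx
  rw [h1, hs x hx]

lemma Admissible.eq_zero_of_isM_zero (ha : Admissible a) {d : Degeneracy} {f : L2}
    (h : IsM d a 0 f) : f = 0 := by
  obtain ⟨-, c, -, -, h0, -⟩ := ha.exists_eq_sol h
  have h1 : EqOn (sol a f c) (fun _ => 0) (Ioo 0 1) := by
    -- By continuity `sol` vanishes everywhere on `(0,1)`; differentiating makes the primitive
    -- constant, and differentiating again gives `f = 0`.
    refine Measure.eqOn_open_of_ae_eq (μ := volume) ?_ isOpen_Ioo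
      (fun x hx => (ha.hasDerivAt_sol f c hx).continuousAt.continuousWithinAt) continuousOn_const
    exact h0.symm.trans (Lp.coeFn_zero ℝ 2 unitMeasure)
  have h2 : ∀ x ∈ Ioo (0 : ℝ) 1, primitive f x = c := by
    intro x hx
    have e1 : deriv (sol a f c) x = 0 :=
      (h1.eventuallyEq_of_mem (isOpen_Ioo.mem_nhds hx)).deriv_eq.trans (deriv_const x 0)
    rw [(ha.hasDerivAt_sol f c hx).deriv, div_eq_zero_iff] at e1
    exact sub_eq_zero.mp (e1.resolve_right (ha.pos x (Ioo_subset_Ioc_self hx)).ne')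
  rw [Lp.eq_zero_iff_ae_eq_zero]
  refine (ae_restrict_iff' measurableSet_Ioo).mpr ?_
  filter_upwards [ae_deriv_primitive f] with x hx hx1
  rw [← hx hx1]
  have e2 : primitive f =ᶠ[𝓝 x] fun _ => c := by
    filter_upwards [isOpen_Ioo.mem_nhds hx1] with y hy
    exact h2 y hy
  rw [e2.deriv_eq, deriv_const, Pi.zero_apply]

lemma Admissible.memLp_flux (ha : Admissible a) {d : Degeneracy} {v : ℝ → ℝ} {f : L2} {c : ℝ}
    (hv : MemH1a d a v) (h : ∀ᵐ x ∂unitMeasure, a x * deriv v x = primitive f x - c) :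
    MemLp (fun x => (primitive f x - c) / √(a x)) 2 unitMeasure := by
  refine hv.memLp_deriv.ae_eq ?_
  filter_upwards [(ae_restrict_iff' measurableSet_Ioo).mpr (ha.ae_deriv_eq h), ae_mem_Ioo]
    with x h1 hx
  rw [h1, ha.sqrt_mul_div _ hx]

end Solution

/-! ### The compact symmetric inverse of `M` -/

section Inverse

variable {a : ℝ → ℝ}

/-- The properties of the inverse of `M` when it has the form `-V* Q V`. -/
lemma Admissible.inverse_properties (ha : Admissible a) {d : Degeneracy} (Q : L2 →L[ℝ] L2)
    (hQ : (Q : L2 →ₗ[ℝ] L2).IsSymmetric)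
    (hM : ∀ u f, IsM d a u f ↔
      u = -ContinuousLinearMap.adjoint ha.volterra (Q (ha.volterra f))) :
    ∃ G : L2 →L[ℝ] L2, (∀ u f, IsM d a u f ↔ u = G f) ∧ Function.Injective G ∧
      (G : L2 →ₗ[ℝ] L2).IsSymmetric ∧ IsCompactOperator G := by
  set G : L2 →L[ℝ] L2 := -(ContinuousLinearMap.adjoint ha.volterra ∘L Q ∘L ha.volterra) with hG
  refine ⟨G, hM, ?_, fun x y => ?_, ?_⟩
  · rw [injective_iff_map_eq_zero]
    intro f hf
    exact ha.eq_zero_of_isM_zero ((hM 0 f).mpr hf.symm)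
  · have h := hQ (ha.volterra x) (ha.volterra y)
    simp only [ContinuousLinearMap.coe_coe] at h ⊢
    simp only [hG, neg_apply, ContinuousLinearMap.comp_apply, inner_neg_left,
      inner_neg_right, ContinuousLinearMap.adjoint_inner_left,
      ContinuousLinearMap.adjoint_inner_right, h]
  · exact ((ha.isCompactOperator_volterra.clm_comp Q).clm_comp
      (ContinuousLinearMap.adjoint ha.volterra)).neg

lemma Admissible.memLp_inv_sqrt (ha : Admissible a)
    (hi : Integrable (fun x => (a x)⁻¹) unitMeasure) :
    MemLp (fun x => 1 / √(a x)) 2 unitMeasure := by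
  rw [memLp_two_iff_integrable_sq (ha.aestronglyMeasurable_div_sqrt continuousOn_const)]
  refine hi.congr ?_
  filter_upwards [ae_mem_Ioo] with x hx
  rw [ha.div_sqrt_sq _ hx, one_pow, one_div]

/-- Finite energy replaces a boundary condition at `0`: it is compatible with the flux constant `c =
0` only. -/
lemma Admissible.exists_inverse_strong (ha : Admissible a)
    (hi : ¬ Integrable (fun x => (a x)⁻¹) unitMeasure) :
    ∃ G : L2 →L[ℝ] L2, (∀ u f, IsM .strong a u f ↔ u = G f) ∧ Function.Injective G ∧
      (G : L2 →ₗ[ℝ] L2).IsSymmetric ∧ IsCompactOperator G := by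
  refine ha.inverse_properties (ContinuousLinearMap.id ℝ L2) (fun x y => rfl) fun u f => ?_
  have hw : ha.volterra f =ᵐ[unitMeasure] fun x => (primitive f x - 0) / √(a x) := by
    simpa only [sub_zero] using ha.volterra_ae f
  have hs := ha.adjoint_volterra_ae_sol hw
  rw [ContinuousLinearMap.id_apply]
  constructor
  · intro h
    obtain ⟨v, c, hv, hc, hu, -⟩ := ha.exists_eq_sol h
    have c0 : c = 0 := by
      by_contra c0
      apply hi
      -- Both `F/√a` and `(F-c)/√a` are in `L²`, where `F = primitive f`; if `c ≠ 0`, their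
      -- difference divided by `c` puts `1/√a` in `L²`.
      have h1 := (((ha.memLp_primitive f).sub (ha.memLp_flux hv hc)).const_mul c⁻¹).integrable_sq
      refine h1.congr ?_
      filter_upwards [ae_mem_Ioo] with x hx
      have hp := ha.pos x (Ioo_subset_Ioc_self hx)
      rw [Pi.sub_apply, ← sub_div, sub_sub_cancel, ← mul_div_assoc, inv_mul_cancel₀ c0,
        ha.div_sqrt_sq _ hx, one_pow, one_div]
    subst c0
    exact Lp.ext (hu.trans hs.symm)
  · rintro rfl
    obtain ⟨h1, h2, h3, h4⟩ := ha.sol_spec hw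
    exact ⟨_, hs, ⟨h1, fun ε hε => absolutelyContinuousOnInterval_sol
      (ha.intervalIntegrable_flux f 0 (Ioo_subset_Ioc_self hε)), h2, h3⟩, h4⟩

/-- With `ρ = a^{-1/2} ∈ L²`, the condition `v(0) = 0` reads `⟪ρ, V f - c ρ⟫ = 0`. So `V f - c ρ` is
the orthogonal projection of `V f` off `ρ`, and this projection is the symmetric operator `Q`. -/
lemma Admissible.exists_inverse_weak (ha : Admissible a)
    (hi : Integrable (fun x => (a x)⁻¹) unitMeasure) :
    ∃ G : L2 →L[ℝ] L2, (∀ u f, IsM .weak a u f ↔ u = G f) ∧ Function.Injective G ∧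
      (G : L2 →ₗ[ℝ] L2).IsSymmetric ∧ IsCompactOperator G := by
  set ρ : L2 := (ha.memLp_inv_sqrt hi).toLp _ with hρ
  have hρ_ae : ρ =ᵐ[unitMeasure] fun x => 1 / √(a x) := (ha.memLp_inv_sqrt hi).coeFn_toLp
  have hnorm : ‖ρ‖ ^ 2 ≠ 0 := by
    intro h0
    have h1 : ρ = 0 := by simpa using h0
    have h2 : ∀ᵐ x ∂unitMeasure, False := by
      filter_upwards [hρ_ae, Lp.eq_zero_iff_ae_eq_zero.mp h1, ae_mem_Ioo] with x e1 e2 hx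
      have hp := Real.sqrt_pos.mpr (ha.pos x (Ioo_subset_Ioc_self hx))
      have h3 : 1 / √(a x) = 0 := e1.symm.trans e2
      exact (one_div_pos.mpr hp).ne' h3
    have h3 : unitMeasure = 0 := ae_eq_bot.mp (eventually_false_iff_eq_bot.mp h2)
    have h4 := unitMeasure_Ioo (x := 1) (by simp)
    rw [h3] at h4
    simp at h4
  let Q : L2 →L[ℝ] L2 := ContinuousLinearMap.id ℝ L2 -
    (‖ρ‖ ^ 2)⁻¹ • (ContinuousLinearMap.toSpanSingleton ℝ ρ ∘L innerSL ℝ ρ)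
  have hQ (x : L2) : Q x = x - ((‖ρ‖ ^ 2)⁻¹ * inner ℝ ρ x) • ρ := by
    simp [Q, smul_smul]
  have hflux (f : L2) (c : ℝ) : ((ha.volterra f - c • ρ : L2) : ℝ → ℝ) =ᵐ[unitMeasure]
      fun x => (primitive f x - c) / √(a x) := by
    filter_upwards [Lp.coeFn_sub (ha.volterra f) (c • ρ), Lp.coeFn_smul c ρ, ha.volterra_ae f,
      hρ_ae] with x h1 h2 h3 h4
    rw [h1, Pi.sub_apply, h2, Pi.smul_apply, h3, h4, smul_eq_mul]
    ring
  have hprod (f : L2) (c : ℝ) : (fun x => inner ℝ (ρ x) ((ha.volterra f - c • ρ : L2) x))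
      =ᵐ[unitMeasure] fun x => (primitive f x - c) / a x := by
    filter_upwards [hflux f c, hρ_ae, ae_mem_Ioo] with x h1 h2 hx
    have hp := ha.pos x (Ioo_subset_Ioc_self hx)
    rw [h1, h2]
    simp only [RCLike.inner_apply, conj_trivial]
    rw [div_mul_div_comm, mul_one, Real.mul_self_sqrt hp.le]
  have hint (f : L2) (c : ℝ) :
      IntervalIntegrable (fun x => (primitive f x - c) / a x) volume 0 1 := by
    rw [intervalIntegrable_iff_integrableOn_Ioo_of_le zero_le_one]
    exact (L2.integrable_inner ρ (ha.volterra f - c • ρ)).congr (hprod f c)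
  have hzero (f : L2) (c : ℝ) : sol a f c 0 = -(inner ℝ ρ (ha.volterra f) - c * ‖ρ‖ ^ 2) := by
    rw [sol, intervalIntegral.integral_of_le zero_le_one, integral_Ioc_eq_integral_Ioo,
      ← integral_congr_ae (hprod f c), ← L2.inner_def, inner_sub_right, inner_smul_right,
      real_inner_self_eq_norm_sq]
  refine ha.inverse_properties Q (fun x y => ?_) fun u f => ?_
  · simp only [ContinuousLinearMap.coe_coe, hQ, inner_sub_left, inner_sub_right, inner_smul_left,
      inner_smul_right, conj_trivial, real_inner_comm x ρ]
    ring
  set c := (‖ρ‖ ^ 2)⁻¹ * inner ℝ ρ (ha.volterra f) with hc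
  have hs := ha.adjoint_volterra_ae_sol (hflux f c)
  rw [hQ, ← hc]
  constructor
  · intro h
    obtain ⟨v, c', hv, hc', hu, -⟩ := ha.exists_eq_sol h
    have h1 := ha.eq_sol hc' (x := 0) (by simp) hv.2.1 hv.apply_one
    rw [hv.2.2.2.1, hzero] at h1
    have e : c' = c := by
      rw [hc, eq_comm, inv_mul_eq_iff_eq_mul₀ hnorm]
      linarith
    subst e
    exact Lp.ext (hu.trans hs.symm)
  · rintro rfl
    obtain ⟨h1, h2, h3, h4⟩ := ha.sol_spec (hflux f c)
    refine ⟨_, hs, ⟨h1, absolutelyContinuousOnInterval_sol (hint f c), h2, ?_, h3⟩, h4⟩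
    rw [hzero, hc, mul_right_comm, inv_mul_cancel₀ hnorm, one_mul, sub_self, neg_zero]

end Inverse

/-! ### Consequences of the growth conditions on `a` -/

section Growth

variable {a : ℝ → ℝ}

/-- The condition `x a' ≤ K a` says that `a(x) x^{-K}` is nonincreasing; compare its values at `x`
and `1`. -/
lemma mul_rpow_le_of_growth {K : ℝ} (hc : ContinuousOn a (Ioc 0 1))
    (hd : DifferentiableOn ℝ a (Ioo 0 1)) (h : ∀ x ∈ Ioo (0 : ℝ) 1, x * deriv a x ≤ K * a x)
    {x : ℝ} (hx : x ∈ Ioc (0 : ℝ) 1) : a 1 * x ^ K ≤ a x := by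
  have hanti : AntitoneOn (fun x => a x * x ^ (-K)) (Ioc 0 1) := by
    refine antitoneOn_of_deriv_nonpos (convex_Ioc 0 1) (hc.mul ?_) ?_ ?_
    · exact fun y hy =>
        (Real.continuousAt_rpow_const y (-K) (Or.inl hy.1.ne')).continuousWithinAt
    · rw [interior_Ioc]
      exact hd.mul fun y hy =>
        (Real.differentiableAt_rpow_const_of_ne (-K) hy.1.ne').differentiableWithinAt
    · rw [interior_Ioc]
      intro y hy
      have h1 := (hd.differentiableAt (isOpen_Ioo.mem_nhds hy)).hasDerivAt
      have h2 := Real.hasDerivAt_rpow_const (p := -K) (Or.inl hy.1.ne')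
      rw [(h1.fun_mul h2).deriv, Real.rpow_sub_one hy.1.ne']
      have h3 : deriv a y * y ^ (-K) + a y * (-K * (y ^ (-K) / y)) =
          (y ^ (-K) / y) * (y * deriv a y - K * a y) := by
        field_simp [hy.1.ne']
        ring
      rw [h3]
      exact mul_nonpos_of_nonneg_of_nonpos
        (div_nonneg (Real.rpow_nonneg hy.1.le _) hy.1.le) (sub_nonpos.mpr (h y hy))
  have h1 := hanti hx (right_mem_Ioc.mpr zero_lt_one) hx.2
  simp only [Real.one_rpow, mul_one] at h1
  rw [Real.rpow_neg hx.1.le, ← div_eq_mul_inv, le_div_iff₀ (Real.rpow_pos_of_pos hx.1 _)] at h1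
  exact h1

lemma integrable_rpow_unitMeasure {r : ℝ} (hr : -1 < r) :
    Integrable (fun x : ℝ => x ^ r) unitMeasure := by
  have h := intervalIntegral.intervalIntegrable_rpow' hr (a := 0) (b := 1)
  rwa [intervalIntegrable_iff_integrableOn_Ioo_of_le zero_le_one] at h

lemma integrable_rpow_div {r K : ℝ} (hr : -1 < r - K) (hc : ContinuousOn a (Ioc 0 1))
    (hpos : ∀ x ∈ Ioc (0 : ℝ) 1, 0 < a x) (h : ∀ x ∈ Ioc (0 : ℝ) 1, a 1 * x ^ K ≤ a x) :
    Integrable (fun x => x ^ r / a x) unitMeasure := by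
  have h1 := hpos 1 (right_mem_Ioc.mpr zero_lt_one)
  refine ((integrable_rpow_unitMeasure hr).const_mul (a 1)⁻¹).mono' ?_ ?_
  · refine ContinuousOn.aestronglyMeasurable (ContinuousOn.div ?_ (hc.mono Ioo_subset_Ioc_self)
      fun x hx => (hpos x (Ioo_subset_Ioc_self hx)).ne') measurableSet_Ioo
    exact fun y hy => (Real.continuousAt_rpow_const y r (Or.inl hy.1.ne')).continuousWithinAt
  · filter_upwards [ae_mem_Ioo] with x hx
    have hx' := Ioo_subset_Ioc_self hx
    have hxr := Real.rpow_pos_of_pos hx.1 r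
    have hxK := Real.rpow_pos_of_pos hx.1 K
    rw [Real.norm_of_nonneg (div_nonneg hxr.le (hpos x hx').le), Real.rpow_sub hx.1,
      inv_mul_eq_div, div_div, mul_comm (x ^ K)]
    exact div_le_div_of_nonneg_left hxr.le (by positivity) (h x hx')

lemma admissible_of_growth {K : ℝ} (hK : K < 2) (hc : ContinuousOn a (Ioc 0 1))
    (hpos : ∀ x ∈ Ioc (0 : ℝ) 1, 0 < a x) (h : ∀ x ∈ Ioc (0 : ℝ) 1, a 1 * x ^ K ≤ a x) :
    Admissible a :=
  ⟨hc, hpos, by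
    simpa using integrable_rpow_div (r := 1) (by linarith : -1 < 1 - K) hc hpos h⟩

lemma WeaklyDegenerate.exists_inverse (ha : WeaklyDegenerate a) :
    ∃ G : L2 →L[ℝ] L2, (∀ u f, IsM .weak a u f ↔ u = G f) ∧ Function.Injective G ∧
      (G : L2 →ₗ[ℝ] L2).IsSymmetric ∧ IsCompactOperator G := by
  obtain ⟨K, hK, hgr⟩ := ha.growth
  have hc := ha.continuousOn.mono Ioc_subset_Icc_self
  have hd : DifferentiableOn ℝ a (Ioo 0 1) :=
    (ha.contDiffOn.differentiableOn (by simp)).mono Ioo_subset_Ioc_self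
  have h : ∀ x ∈ Ioc (0 : ℝ) 1, a 1 * x ^ K ≤ a x := fun x hx =>
    mul_rpow_le_of_growth hc hd (fun y hy => by
      have := hgr y (Ioo_subset_Ioc_self hy)
      rwa [derivWithin_of_mem_nhds (Ioc_mem_nhds hy.1 hy.2)] at this) hx
  refine (admissible_of_growth (by linarith [hK.2]) hc ha.pos h).exists_inverse_weak ?_
  simpa using integrable_rpow_div (r := 0) (by linarith [hK.2] : -1 < 0 - K) hc ha.pos h

/-- Since `a` is `C¹` up to `0` with `a(0) = 0`, it is at most `L x`, so integrability of `1/a`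
would give that of `1/x`. -/
lemma StronglyDegenerate.not_integrable_inv (ha : StronglyDegenerate a) :
    ¬ Integrable (fun x => (a x)⁻¹) unitMeasure := by
  intro hi
  obtain ⟨L, hL⟩ := ha.contDiffOn.exists_lipschitzOnWith (by simp) (convex_Icc 0 1) isCompact_Icc
  have hle : ∀ x ∈ Ioo (0 : ℝ) 1, a x ≤ L * x := fun x hx => by
    have := hL.dist_le_mul x (Ioo_subset_Icc_self hx) 0 (by simp)
    rw [ha.zero, dist_zero_right, dist_zero_right, Real.norm_of_nonneg hx.1.le] at this
    exact (le_abs_self _).trans this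
  have h2 : IntervalIntegrable (fun x : ℝ => x⁻¹) volume 0 1 := by
    rw [intervalIntegrable_iff_integrableOn_Ioo_of_le zero_le_one]
    refine (hi.const_mul (L : ℝ)).mono' measurable_inv.aestronglyMeasurable ?_
    filter_upwards [ae_mem_Ioo] with x hx
    have hp := ha.pos x (Ioo_subset_Ioc_self hx)
    rw [Real.norm_of_nonneg (inv_nonneg.mpr hx.1.le), ← div_eq_mul_inv, le_div_iff₀ hp,
      inv_mul_eq_div, div_le_iff₀ hx.1]
    exact hle x hx
  simp at h2

lemma StronglyDegenerate.exists_inverse (ha : StronglyDegenerate a) :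
    ∃ G : L2 →L[ℝ] L2, (∀ u f, IsM .strong a u f ↔ u = G f) ∧ Function.Injective G ∧
      (G : L2 →ₗ[ℝ] L2).IsSymmetric ∧ IsCompactOperator G := by
  obtain ⟨K, hK, hgr, -⟩ := ha.growth
  have hc := ha.contDiffOn.continuousOn.mono Ioc_subset_Icc_self
  have hd : DifferentiableOn ℝ a (Ioo 0 1) :=
    (ha.contDiffOn.differentiableOn (by simp)).mono Ioo_subset_Icc_self
  have h : ∀ x ∈ Ioc (0 : ℝ) 1, a 1 * x ^ K ≤ a x := fun x hx =>
    mul_rpow_le_of_growth hc hd (fun y hy => by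
      have := hgr y (Ioo_subset_Icc_self hy)
      rwa [derivWithin_of_mem_nhds (Icc_mem_nhds hy.1 hy.2)] at this) hx
  exact (admissible_of_growth hK.2 hc ha.pos h).exists_inverse_strong ha.not_integrable_inv

lemma IsDiffusion.exists_inverse {d : Degeneracy} (ha : IsDiffusion d a) :
    ∃ G : L2 →L[ℝ] L2, (∀ u f, IsM d a u f ↔ u = G f) ∧ Function.Injective G ∧
      (G : L2 →ₗ[ℝ] L2).IsSymmetric ∧ IsCompactOperator G := by
  cases d with
  | weak => exact WeaklyDegenerate.exists_inverse ha
  | strong => exact StronglyDegenerate.exists_inverse ha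

lemma exists_L2_ne_zero : ∃ x : L2, x ≠ 0 := by
  refine ⟨indicatorConstLp 2 (measurableSet_Ioo : MeasurableSet (Ioo (0 : ℝ) 1))
    (measure_ne_top unitMeasure _) (1 : ℝ), fun h => ?_⟩
  have := norm_indicator_Ioo_sq (x := 1) (by simp)
  rw [h] at this
  simp at this

end Growth

end DegenerateKalman

theorem theorem2p5 (d : Degeneracy) (a : ℝ → ℝ) (ha : IsDiffusion d a)
    {n m : ℕ} (hn : 1 ≤ n) (hm : 1 ≤ m)
    (D A : Matrix (Fin n) (Fin n) ℝ) (B : Matrix (Fin n) (Fin m) ℝ) :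
    (∃ C : ℝ, 0 < C ∧ ∀ u w : L2Vec (Fin n × Fin m), IsMPowVec d a (n - 1) u w →
      (∃ f, IsKalman d a D A B u f) ∧
      ∀ f, IsKalman d a D A B u f → ‖f‖ ^ 2 ≤ C * ‖w‖ ^ 2) ∧
    (∃ C : ℝ, 0 < C ∧ ∀ u w : L2Vec (Fin n), IsMPowVec d a (n - 1) u w →
      (∃ f, IsKalmanAdjoint d a D A B u f) ∧
      ∀ f, IsKalmanAdjoint d a D A B u f → ‖f‖ ^ 2 ≤ C * ‖w‖ ^ 2) ∧
    ((∀ φ : L2Vec (Fin n), IsKalmanAdjoint d a D A B φ 0 → φ = 0) →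
      ∃ C : ℝ, 0 < C ∧ ∀ k : ℕ, (2 * n - 1) * (n - 1) ≤ k →
        ∀ (φ : L2Vec (Fin n)) (g z : L2Vec (Fin n × Fin m)),
          IsKalmanAdjoint d a D A B φ g → IsMPowVec d a k g z →
          (∃ y, IsMPowVec d a (k - (2 * n - 1) * (n - 1)) φ y) ∧
          ∀ y, IsMPowVec d a (k - (2 * n - 1) * (n - 1)) φ y → ‖y‖ ^ 2 ≤ C * ‖z‖ ^ 2) := by
  obtain ⟨G, hM, hinj, hG, hc⟩ := ha.exists_inverse
  exact kalman_estimates hM hinj hG hc exists_L2_ne_zero hn D A B
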